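/- Notation. Let $\mathbb H$ be the upper half-plane, $z=x+iy\in\mathbb H$. For $k\in 2\mathbb Z$ and $\operatorname{Re}(s)>1-\tfrac k2$ let $$E_k(z,s)=\frac12\sum_{(m,n)\in\mathbb Z^2\setminus\{(0,0)\}}\frac{y^s}{|mz+n|^{2s}(mz+n)^k},\qquad \widehat E_k(z,s)=\pi^{-(s+\frac k2)}\,\Gamma\!\left(s+\tfrac k2+\tfrac{|k|}2\right)E_k(z,s).$$ For every fixed $z$ the completed series $\widehat E_k(z,\cdot)$ continues to a meromorphic function on $\mathbb C$, denoted by the same symbol. It is entire if $k\neq0$, and holomorphic outside $\{0,1\}$ if $k=0$. The doubly-completed series is the entire function of $s$ $$\widehat{\widehat E}_k(z,s)=\left(s+\tfrac k2\right)\left(s+\tfrac k2-1\right)\widehat E_k(z,s)$$ (removable singularities removed). For a real-differentiable $f:\mathbb H\to\mathbb C$ put $$\xi_k f=2i\,y^k\,\overline{\frac{\partial f}{\partial\bar z}},\qquad \frac{\partial}{\partial\bar z}=\frac12\left(\frac{\partial}{\partial x}+i\frac{\partial}{\partial y}\right).$$ Proposition. Let $k\in2\mathbb Z$. The continuations just described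 exist. The functions $z\mapsto\widehat E_k(z,s)$ (for $s\in\mathbb C$, with $s\neq0,1$ if $k=0$) and $z\mapsto\widehat{\widehat E}_k(z,s)$ (for all $s\in\mathbb C$) are real-differentiable on $\mathbb H$. For all $z\in\mathbb H$ and all $s\in\mathbb C$, with $s\ne 0,1$ if $k=0$, $$\xi_k\widehat E_k(z,s)=\begin{cases}\widehat E_{2-k}(z,-\bar s)&\text{if }k\le0,\\[2pt] \bar s(\bar s+k-1)\,\widehat E_{2-k}(z,-\bar s)&\text{if }k\ge2,\end{cases}$$ where for $k=2$ and $s\in\{0,-1\}$, which are removable singularities of the right-hand side, the right-hand side is understood as its limit. Moreover, for all $z\in\mathbb H$ and all $s\in\mathbb C$, $$\xi_k\widehat{\widehat E}_k(z,s)=\begin{cases}\widehat{\widehat E}_{2-k}(z,-\bar s)&\text{if }k\le0,\\[2pt] \bar s(\bar s+k-1)\,\widehat{\widehat E}_{2-k}(z,-\bar s)&\text{if }k\ge2.\end{cases}$$ -/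

import Mathlib

open Filter Topology
open scoped ComplexConjugate UpperHalfPlane

noncomputable section

namespace PolyharmonicMaass

/-- The Eisenstein series of weight `k`, as an infinite series over nonzero pairs of integers:
`(1/2) ∑_{(m,n) ≠ (0,0)} y ^ s / (|m z + n| ^ (2 s) (m z + n) ^ k)`.
It converges (absolutely) for `Re s > 1 - k / 2`. -/
def eisensteinSeries (k : ℤ) (z : ℍ) (s : ℂ) : ℂ :=
  (1 / 2 : ℂ) * ∑' p : {p : ℤ × ℤ // p ≠ 0},
    ((z.im : ℝ) : ℂ) ^ s /
      (((‖(p.1.1 : ℂ) * (z : ℂ) + (p.1.2 : ℂ)‖ : ℝ) : ℂ) ^ (2 * s) *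
        ((p.1.1 : ℂ) * (z : ℂ) + (p.1.2 : ℂ)) ^ k)

/-- The completed series `π ^ (-(s + k/2)) Γ(s + k/2 + |k|/2) E_k(z, s)`, given by the
infinite series; meaningful for `Re s > 1 - k / 2`. -/
def completedEisensteinSeries (k : ℤ) (z : ℍ) (s : ℂ) : ℂ :=
  (Real.pi : ℂ) ^ (-(s + (k : ℂ) / 2)) *
    Complex.Gamma (s + (k : ℂ) / 2 + ((|k| : ℤ) : ℂ) / 2) * eisensteinSeries k z s

/-- `F` is a meromorphic function on the whole plane that agrees with `f` on the half-plane
`Re s > σ`. The normal form fixes the values of `F` pointwise: it is analytic at every point that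
is not a pole, and has the conventional value `0` at its poles. By the identity
theorem there is at most one such `F`. -/
def IsMeromorphicContinuation (F f : ℂ → ℂ) (σ : ℝ) : Prop :=
  MeromorphicNFOn F Set.univ ∧ ∀ s : ℂ, σ < s.re → F s = f s

/-- The meromorphic continuation to the plane of `f`, given on `Re s > σ`. -/
def meromorphicContinuation (f : ℂ → ℂ) (σ : ℝ) : ℂ → ℂ :=
  Classical.epsilon fun F => IsMeromorphicContinuation F f σ

/-- The completed Eisenstein series, continued meromorphically in `s` for each fixed `z`. -/
def completedEisenstein (k : ℤ) (z : ℍ) : ℂ → ℂ :=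
  meromorphicContinuation (completedEisensteinSeries k z) (1 - (k : ℝ) / 2)

/-- The doubly-completed Eisenstein series: the product of `(s + k/2) (s + k/2 - 1)` and the
completed Eisenstein series, as a meromorphic function of `s` (that is, with
the removable singularities removed). -/
def doublyCompletedEisenstein (k : ℤ) (z : ℍ) : ℂ → ℂ :=
  toMeromorphicNFOn
    (fun s : ℂ => (s + (k : ℂ) / 2) * (s + (k : ℂ) / 2 - 1) * completedEisenstein k z s) Set.univ

/-- A function on the upper half-plane is real differentiable at `z`, as a function of
`(x, y)`. -/
def RealDifferentiableAt (f : ℍ → ℂ) (z : ℍ) : Prop :=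
  DifferentiableAt ℝ (fun w : ℂ => f (UpperHalfPlane.ofComplex w)) (z : ℂ)

/-- The Wirtinger derivative `∂f/∂z̄ = (1/2) (∂f/∂x + i ∂f/∂y)` on the upper half-plane. -/
def wirtingerBar (f : ℍ → ℂ) (z : ℍ) : ℂ :=
  (1 / 2 : ℂ) * (fderiv ℝ (fun w : ℂ => f (UpperHalfPlane.ofComplex w)) (z : ℂ) 1 +
    Complex.I * fderiv ℝ (fun w : ℂ => f (UpperHalfPlane.ofComplex w)) (z : ℂ) Complex.I)

/-- The operator `ξ_k f = 2 i y ^ k * conj (∂f/∂z̄)`. -/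
def xi (k : ℤ) (f : ℍ → ℂ) (z : ℍ) : ℂ :=
  2 * Complex.I * ((z.im : ℝ) : ℂ) ^ k * conj (wirtingerBar f z)

/-- The points `s` at which the completed Eisenstein series of weight `k` has a pole:
`s = 0` and `s = 1` in weight `0`, and no points in the other weights. -/
def IsEisensteinPole (k : ℤ) (s : ℂ) : Prop := k = 0 ∧ (s = 0 ∨ s = 1)

end PolyharmonicMaass

end

/-!
The completed series is, up to elementary factors, the Mellin transform of a theta function, a sum
over `ℤ²` of a harmonic polynomial times a Gaussian. The functional equation of the theta function
(Poisson summation) lets one fold the integral to `t ≥ 1` as Riemann did: this continues the series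
in `s`, with the zeroth term of the theta function accounting for the poles in weight `0`, and gives
the symmetry `s ↦ 1 - k - s`. In the region of convergence `ξ_k` may be applied term by term, which
turns `E_k(z, s)` into `conj s * E_{2-k}(z, conj s + k - 1)`; by the symmetry in weight `2 - k`, the
argument `conj s + k - 1` may be replaced by `-conj s` in the completed series. Both sides are
holomorphic in `conj s`, so the identity holds for all `s` by the identity theorem.
-/

noncomputable section

namespace PolyharmonicMaass

open Complex Set MeasureTheory

lemma arg_ofReal_ne_pi {x : ℝ} (hx : 0 ≤ x) : arg (x : ℂ) ≠ Real.pi := by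
  rw [arg_ofReal_of_nonneg hx]
  exact Real.pi_ne_zero.symm

section UpperMellin

variable {E : Type*} [NormedAddCommGroup E]

/-- Rapid decrease at infinity, with continuity on `[1, ∞)`; nothing is required on `(0, 1)`. -/
structure IsRapidlyDecreasing (h : ℝ → E) : Prop where
  continuousOn : ContinuousOn h (Ici 1)
  exists_norm_le : ∀ N : ℕ, ∃ C : ℝ, ∀ t : ℝ, 1 ≤ t → ‖h t‖ ≤ C * (t ^ N)⁻¹

/-- The Mellin integral `∫₁^∞ t^(S - 1) h(t) dt`, written as the Mellin transform of a truncation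
so that the library applies to it. -/
def upperMellin [NormedSpace ℂ E] (h : ℝ → E) (S : ℂ) : E := mellin ((Ioi 1).indicator h) S

namespace IsRapidlyDecreasing

variable {h : ℝ → E}

lemma isBigO_indicator_atTop (hh : IsRapidlyDecreasing h) (N : ℕ) :
    (Ioi 1).indicator h =O[atTop] (· ^ (-N : ℝ)) := by
  obtain ⟨C, hC⟩ := hh.exists_norm_le N
  refine Asymptotics.IsBigO.of_bound C ?_
  filter_upwards [eventually_gt_atTop 1] with t ht
  have ht0 : 0 < t := one_pos.trans ht
  rw [indicator_of_mem (mem_Ioi.2 ht), Real.rpow_neg ht0.le, Real.rpow_natCast,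
    Real.norm_of_nonneg (by positivity)]
  exact hC t ht.le

lemma isBigO_indicator_zero (b : ℝ) : (Ioi 1).indicator h =O[𝓝[>] 0] (· ^ (-b)) := by
  refine Asymptotics.IsBigO.of_bound 0 ?_
  filter_upwards [nhdsWithin_le_nhds (Iio_mem_nhds one_pos)] with t ht
  rw [indicator_of_notMem (notMem_Ioi.2 (le_of_lt ht)), norm_zero, zero_mul]

lemma locallyIntegrableOn_indicator (hh : IsRapidlyDecreasing h) :
    LocallyIntegrableOn ((Ioi 1).indicator h) (Ioi 0) := by
  have hIci : LocallyIntegrable ((Ici 1).indicator h) := by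
    rw [locallyIntegrable_iff]
    intro K hK
    rw [IntegrableOn, integrable_indicator_iff measurableSet_Ici, IntegrableOn,
      Measure.restrict_restrict measurableSet_Ici]
    exact (hh.continuousOn.mono inter_subset_left).integrableOn_compact
      (hK.inter_left isClosed_Ici)
  have hIoi := hIci.indicator measurableSet_Ioi (s := Ioi 1)
  rw [indicator_indicator, inter_eq_left.2 Ioi_subset_Ici_self] at hIoi
  exact hIoi.locallyIntegrableOn _

variable [NormedSpace ℂ E]

lemma mellinConvergent (hh : IsRapidlyDecreasing h) (S : ℂ) :
    MellinConvergent ((Ioi 1).indicator h) S := by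
  obtain ⟨N, hN⟩ := exists_nat_gt S.re
  exact mellinConvergent_of_isBigO_rpow hh.locallyIntegrableOn_indicator
    (hh.isBigO_indicator_atTop N) hN (isBigO_indicator_zero _) (sub_one_lt S.re)

lemma differentiable_upperMellin (hh : IsRapidlyDecreasing h) :
    Differentiable ℂ (upperMellin h) := by
  intro S
  obtain ⟨N, hN⟩ := exists_nat_gt S.re
  exact mellin_differentiableAt_of_isBigO_rpow hh.locallyIntegrableOn_indicator
    (hh.isBigO_indicator_atTop N) hN (isBigO_indicator_zero _) (sub_one_lt S.re)

end IsRapidlyDecreasing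

lemma hasFDerivAt_upperMellin {F : Type*} [NormedAddCommGroup F] [NormedSpace ℝ F]
    {H : F → ℝ → ℂ} {H' : F → ℝ → F →L[ℝ] ℂ} {z : F} {s : Set F} (hs : s ∈ 𝓝 z)
    (hH : ∀ w ∈ s, IsRapidlyDecreasing (H w)) (hH' : ContinuousOn (H' z) (Ici 1))
    (hbound : ∀ N : ℕ, ∃ C : ℝ, ∀ w ∈ s, ∀ t : ℝ, 1 ≤ t → ‖H' w t‖ ≤ C * (t ^ N)⁻¹)
    (hderiv : ∀ w ∈ s, ∀ t : ℝ, 1 ≤ t → HasFDerivAt (fun w => H w t) (H' w t) w) (S : ℂ) :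
    HasFDerivAt (fun w => upperMellin (H w) S) (upperMellin (H' z) S) z := by
  obtain ⟨N, hN⟩ := exists_nat_gt S.re
  obtain ⟨C, hC⟩ := hbound N
  have hmem : ∀ w ∈ s, MellinConvergent ((Ioi 1).indicator (H w)) S := fun w hw =>
    (hH w hw).mellinConvergent S
  have hderivZ : IsRapidlyDecreasing (H' z) :=
    ⟨hH', fun N => (hbound N).imp fun C hC => hC z (mem_of_mem_nhds hs)⟩
  refine hasFDerivAt_integral_of_dominated_of_fderiv_le (𝕜 := ℝ)
    (F' := fun w (t : ℝ) => (t : ℂ) ^ (S - 1) • (Ioi 1).indicator (H' w) t)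
    (bound := (Ioi 1).indicator fun t => C * t ^ (S.re - 1 - N)) hs ?_
    (hmem z (mem_of_mem_nhds hs)) (hderivZ.mellinConvergent S).aestronglyMeasurable
    ?_ ?_ ?_
  · filter_upwards [hs] with w hw using (hmem w hw).aestronglyMeasurable
  · refine ae_of_all _ fun t w hw => ?_
    by_cases ht : t ∈ Ioi (1 : ℝ)
    · have ht0 : 0 < t := one_pos.trans ht
      simp only [indicator_of_mem ht]
      rw [norm_smul, norm_cpow_eq_rpow_re_of_pos ht0, sub_re, one_re,
        Real.rpow_sub_natCast ht0.ne', div_eq_mul_inv, mul_left_comm]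
      exact mul_le_mul_of_nonneg_left (hC w hw t (le_of_lt ht)) (by positivity)
    · simp [indicator_of_notMem ht]
  · rw [integrable_indicator_iff measurableSet_Ioi, IntegrableOn,
      Measure.restrict_restrict measurableSet_Ioi]
    exact ((integrableOn_Ioi_rpow_of_lt (by linarith) one_pos).const_mul C).mono_measure
      (Measure.restrict_mono inter_subset_left le_rfl)
  · refine ae_of_all _ fun t w hw => HasFDerivAt.const_smul ?_ ((t : ℂ) ^ (S - 1))
    by_cases ht : t ∈ Ioi (1 : ℝ)
    · simpa only [indicator_of_mem ht] using hderiv w hw t (le_of_lt ht)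
    · simpa only [indicator_of_notMem ht] using hasFDerivAt_const (0 : ℂ) w

lemma hasMellin_inversion {h : ℝ → ℂ} (hh : IsRapidlyDecreasing h) (κ S : ℂ) :
    HasMellin (fun t => (t : ℂ) ^ (-κ) • (Ioi 1).indicator h t⁻¹) S (upperMellin h (κ - S)) := by
  constructor
  · simp_rw [MellinConvergent.cpow_smul, ← Real.rpow_neg_one]
    rw [MellinConvergent.comp_rpow (by norm_num)]
    simpa [div_neg, sub_eq_add_neg] using hh.mellinConvergent (κ - S)
  · rw [mellin_cpow_smul, mellin_comp_inv]
    simp only [upperMellin, neg_add_rev, neg_neg, sub_eq_add_neg]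

lemma hasMellin_const_smul_indicator_sub {κ c S : ℂ} (hS : c ≠ 0 → 0 < S.re ∧ κ.re < S.re) :
    HasMellin (fun t => c • ((Ioc 0 1).indicator (fun t : ℝ => (t : ℂ) ^ (-κ)) t -
      (Ioc 0 1).indicator (fun _ => (1 : ℂ)) t)) S (c * (1 / (S - κ) - 1 / S)) := by
  rcases eq_or_ne c 0 with rfl | hc
  · simp [HasMellin, MellinConvergent, mellin]
  · have hone := hasMellin_one_Ioc (hS hc).1
    have hpow := hasMellin_cpow_Ioc (-κ) (by simpa using (hS hc).2)
    have htotal := hasMellin_const_smul (hasMellin_sub hpow.1 hone.1).1 c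
    rwa [(hasMellin_sub hpow.1 hone.1).2, hpow.2, hone.2, smul_eq_mul, ← sub_eq_add_neg] at htotal

lemma eq_indicator_add_inversion {h : ℝ → ℂ} {κ c : ℂ}
    (hinv : ∀ t : ℝ, 0 < t → h t⁻¹ + c = (t : ℂ) ^ κ * (h t + c)) {t : ℝ} (ht : 0 < t)
    (ht1 : t ≠ 1) :
    h t = (Ioi 1).indicator h t + (t : ℂ) ^ (-κ) • (Ioi 1).indicator h t⁻¹ +
      c • ((Ioc 0 1).indicator (fun t : ℝ => (t : ℂ) ^ (-κ)) t -
        (Ioc 0 1).indicator (fun _ => (1 : ℂ)) t) := by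
  rcases ht1.lt_or_gt with hlt | hgt
  · have hfe := hinv t⁻¹ (inv_pos.2 ht)
    have hmem : t ∈ Ioc (0 : ℝ) 1 := ⟨ht, hlt.le⟩
    rw [inv_inv, ofReal_inv, inv_cpow _ _ (arg_ofReal_ne_pi ht.le), ← cpow_neg] at hfe
    rw [indicator_of_notMem (notMem_Ioi.2 hlt.le), indicator_of_mem hmem, indicator_of_mem hmem,
      indicator_of_mem (mem_Ioi.2 ((one_lt_inv₀ ht).2 hlt)), smul_eq_mul, smul_eq_mul]
    linear_combination hfe
  · have hnotMem : t ∉ Ioc (0 : ℝ) 1 := fun h => hgt.not_ge h.2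
    rw [indicator_of_mem (mem_Ioi.2 hgt), indicator_of_notMem hnotMem,
      indicator_of_notMem hnotMem,
      indicator_of_notMem (notMem_Ioi.2 (inv_le_one_of_one_le₀ hgt.le))]
    simp only [smul_zero, sub_zero, add_zero]

-- Riemann's splitting: the substitution `t ↦ t⁻¹` turns the integral over `(0, 1)` into one
-- over `(1, ∞)`.
lemma mellin_eq_upperMellin_add {h : ℝ → ℂ} (hh : IsRapidlyDecreasing h) {κ c S : ℂ}
    (hinv : ∀ t : ℝ, 0 < t → h t⁻¹ + c = (t : ℂ) ^ κ * (h t + c))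
    (hS : c ≠ 0 → 0 < S.re ∧ κ.re < S.re) :
    mellin h S =
      upperMellin h S + upperMellin h (κ - S) + c * (1 / (S - κ) - 1 / S) := by
  have hupper := hh.mellinConvergent S
  have hlower := hasMellin_inversion hh κ S
  have hconst := hasMellin_const_smul_indicator_sub hS
  rw [upperMellin, ← hlower.2, ← hconst.2, ← (hasMellin_add hupper hlower.1).2,
    ← (hasMellin_add (hasMellin_add hupper hlower.1).1 hconst.1).2]
  refine setIntegral_congr_ae measurableSet_Ioi ?_
  filter_upwards [compl_mem_ae_iff.2 (measure_singleton (1 : ℝ))] with t ht1 ht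
  exact congrArg _ (eq_indicator_add_inversion hinv ht ht1)

end UpperMellin

section LatticeSum

/-- The index set `ℤ² ∖ {0}` of all lattice sums. -/
abbrev NonzeroPair : Type := {p : ℤ × ℤ // p ≠ 0}

/-- The linear form `m w + n` attached to the pair `p = (m, n)`. -/
def linForm (p : ℤ × ℤ) (w : ℂ) : ℂ := p.1 * w + p.2

/-- The quadratic form `|m w + n|² / Im w` attached to the pair `p = (m, n)`; it has
discriminant `-4`. -/
def quadForm (p : ℤ × ℤ) (w : ℂ) : ℝ := normSq (linForm p w) / w.im

/-- The term `(m w + n)⁻ᵏ g(|m w + n|² / Im w)` of a lattice sum. -/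
def latticeTerm (k : ℤ) (g : ℝ → ℂ) (p : ℤ × ℤ) (w : ℂ) : ℂ :=
  linForm p w ^ (-k) * g (quadForm p w)

/-- The lattice sum of weight `k` with radial profile `g`. Eisenstein series are the case of a
power `g`, theta functions the case of an exponential. -/
def latticeSum (k : ℤ) (g : ℝ → ℂ) (w : ℂ) : ℂ := ∑' p : NonzeroPair, latticeTerm k g p w

lemma linForm_im (p : ℤ × ℤ) (w : ℂ) : (linForm p w).im = p.1 * w.im := by simp [linForm]

lemma linForm_ne_zero {p : ℤ × ℤ} (hp : p ≠ 0) {w : ℂ} (hw : 0 < w.im) : linForm p w ≠ 0 := by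
  intro h
  have hfst : p.1 = 0 := by simpa [linForm_im, hw.ne'] using congrArg im h
  exact hp (Prod.ext hfst (by simpa [linForm, hfst] using h))

lemma quadForm_pos {p : ℤ × ℤ} (hp : p ≠ 0) {w : ℂ} (hw : 0 < w.im) : 0 < quadForm p w :=
  div_pos (normSq_pos.2 (linForm_ne_zero hp hw)) hw

lemma summable_norm_rpow_neg {a : ℝ} (ha : 2 < a) :
    Summable fun p : NonzeroPair => ‖p.1‖ ^ (-a) := by
  have h := EisensteinSeries.summable_one_div_norm_rpow ha
  rw [← (finTwoArrowEquiv ℤ).symm.summable_iff] at h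
  refine (h.congr fun p => ?_).subtype (f := fun p : ℤ × ℤ => ‖p‖ ^ (-a)) _
  simp [EisensteinSeries.norm_eq_max_natAbs, Prod.norm_def, Int.norm_eq_abs]

lemma norm_linForm_zpow_mul_quadForm_rpow {p : ℤ × ℤ} (hp : p ≠ 0) {w : ℂ} (hw : 0 < w.im)
    (k : ℤ) (A : ℝ) :
    ‖linForm p w ^ (-k)‖ * quadForm p w ^ (-A) = w.im ^ A * ‖linForm p w‖ ^ (-(2 * A + k)) := by
  have hl : 0 < ‖linForm p w‖ := norm_pos_iff.2 (linForm_ne_zero hp hw)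
  calc
    _ = ‖linForm p w‖ ^ (-k : ℝ) * (‖linForm p w‖ ^ (2 * -A) * w.im ^ A) := by
      rw [norm_zpow, ← Real.rpow_intCast, quadForm, normSq_eq_norm_sq,
        Real.div_rpow (by positivity) hw.le, Real.rpow_mul hl.le, Real.rpow_two,
        Real.rpow_neg hw.le, div_inv_eq_mul, Int.cast_neg]
    _ = _ := by
      rw [← mul_assoc, ← Real.rpow_add hl, mul_comm]
      ring_nf

lemma exists_norm_linForm_rpow_le {z : ℂ} (hz : 0 < z.im) {a : ℝ} (ha : 0 ≤ a) :
    ∃ c : ℝ, ∀ w ∈ Metric.ball z (z.im / 2), ∀ p : ℤ × ℤ,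
      ‖linForm p w‖ ^ (-a) ≤ c * ‖p‖ ^ (-a) := by
  have hy : 0 < z.im / 2 := by positivity
  refine ⟨EisensteinSeries.r ⟨⟨|z.re| + z.im, z.im / 2⟩, hy⟩ ^ (-a), fun w hw p => ?_⟩
  rw [Metric.mem_ball, dist_eq_norm] at hw
  have him := abs_lt.1 ((abs_im_le_norm (w - z)).trans_lt hw)
  have hre := abs_lt.1 ((abs_re_le_norm (w - z)).trans_lt hw)
  simp only [sub_im, sub_re] at him hre
  have hmem : (⟨w, by linarith⟩ : ℍ) ∈ UpperHalfPlane.verticalStrip (|z.re| + z.im) (z.im / 2) :=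
    ⟨abs_le.2 (by change _ ≤ w.re ∧ w.re ≤ _; constructor <;> grind), by
      change _ ≤ w.im; linarith⟩
  simpa [linForm, EisensteinSeries.norm_eq_max_natAbs, Prod.norm_def, Int.norm_eq_abs] using
    EisensteinSeries.summand_bound_of_mem_verticalStrip ha ![p.1, p.2] hy hmem

lemma im_bounds_of_mem_ball {z w : ℂ} (hw : w ∈ Metric.ball z (z.im / 2)) :
    z.im / 2 < w.im ∧ w.im < 2 * z.im ∧ 0 < w.im := by
  rw [Metric.mem_ball, dist_eq_norm] at hw
  have h := abs_lt.1 ((abs_im_le_norm (w - z)).trans_lt hw)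
  have := (norm_nonneg _).trans_lt hw
  simp only [sub_im] at h
  refine ⟨?_, ?_, ?_⟩ <;> linarith

lemma exists_summable_bound_linForm_quadForm {k : ℤ} {A : ℝ} (hkA : 2 < 2 * A + k) {z : ℂ}
    (hz : 0 < z.im) :
    ∃ u : NonzeroPair → ℝ, Summable u ∧ ∀ w ∈ Metric.ball z (z.im / 2), ∀ p : NonzeroPair,
      ‖linForm p w ^ (-k)‖ * quadForm p w ^ (-A) ≤ u p := by
  obtain ⟨c, hc⟩ := exists_norm_linForm_rpow_le hz (a := 2 * A + k) (by linarith)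
  refine ⟨fun p => ((z.im / 2) ^ A + (2 * z.im) ^ A) * (c * ‖p.1‖ ^ (-(2 * A + k))),
    ((summable_norm_rpow_neg hkA).mul_left _).mul_left _, fun w hw p => ?_⟩
  obtain ⟨hlow, hhigh, hw0⟩ := im_bounds_of_mem_ball hw
  have him : w.im ^ A ≤ (z.im / 2) ^ A + (2 * z.im) ^ A := by
    rcases le_total 0 A with hA | hA
    · exact (Real.rpow_le_rpow hw0.le hhigh.le hA).trans
        (le_add_of_nonneg_left (by positivity))
    · exact (Real.rpow_le_rpow_of_nonpos (by positivity) hlow.le hA).trans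
        (le_add_of_nonneg_right (by positivity))
  rw [norm_linForm_zpow_mul_quadForm_rpow p.2 hw0]
  exact mul_le_mul him (hc w hw p) (by positivity) (by positivity)

/-- A radial profile `g` with derivative `g'` on `(0, ∞)`, such that `g(x)` and `x g'(x)` are
bounded by `C x⁻ᴬ`. The constant is explicit because it has to be tracked in families of
profiles. -/
structure IsDecayingProfile (A C : ℝ) (g g' : ℝ → ℂ) : Prop where
  hasDerivAt : ∀ x, 0 < x → HasDerivAt g (g' x) x
  norm_le : ∀ x, 0 < x → ‖g x‖ ≤ C * x ^ (-A)
  norm_deriv_le : ∀ x, 0 < x → ‖g' x‖ ≤ C * x ^ (-A - 1)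

lemma IsDecayingProfile.nonneg {A C : ℝ} {g g' : ℝ → ℂ} (h : IsDecayingProfile A C g g') :
    0 ≤ C := by
  simpa using (norm_nonneg _).trans (h.norm_le 1 one_pos)

lemma norm_latticeTerm_le {k : ℤ} {A C : ℝ} {g : ℝ → ℂ}
    (hg : ∀ x, 0 < x → ‖g x‖ ≤ C * x ^ (-A)) {p : ℤ × ℤ} (hp : p ≠ 0) {w : ℂ} (hw : 0 < w.im) :
    ‖latticeTerm k g p w‖ ≤ C * (‖linForm p w ^ (-k)‖ * quadForm p w ^ (-A)) := by
  rw [latticeTerm, norm_mul, mul_left_comm]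
  gcongr
  exact hg _ (quadForm_pos hp hw)

lemma summable_latticeTerm {k : ℤ} {A C : ℝ} (hkA : 2 < 2 * A + k) {g : ℝ → ℂ}
    (hg : ∀ x, 0 < x → ‖g x‖ ≤ C * x ^ (-A)) {w : ℂ} (hw : 0 < w.im) :
    Summable fun p : NonzeroPair => latticeTerm k g p w := by
  obtain ⟨u, hu, hbound⟩ := exists_summable_bound_linForm_quadForm hkA hw
  have hsum : Summable fun p : NonzeroPair => ‖linForm p w ^ (-k)‖ * quadForm p w ^ (-A) := by
    refine hu.of_nonneg_of_le (fun p => ?_) (hbound w (Metric.mem_ball_self (by positivity)))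
    have := (quadForm_pos p.2 hw).le
    positivity
  exact (hsum.mul_left C).of_norm_bounded fun p => norm_latticeTerm_le hg p.2 hw

lemma latticeTerm_congr {k : ℤ} {g₁ g₂ : ℝ → ℂ} (h : ∀ x, 0 < x → g₁ x = g₂ x)
    {p : ℤ × ℤ} (hp : p ≠ 0) {w : ℂ} (hw : 0 < w.im) :
    latticeTerm k g₁ p w = latticeTerm k g₂ p w := by
  rw [latticeTerm, latticeTerm, h _ (quadForm_pos hp hw)]

lemma latticeSum_congr {k : ℤ} {g₁ g₂ : ℝ → ℂ} (h : ∀ x, 0 < x → g₁ x = g₂ x)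
    {w : ℂ} (hw : 0 < w.im) : latticeSum k g₁ w = latticeSum k g₂ w :=
  tsum_congr fun p => latticeTerm_congr h p.2 hw

lemma latticeSum_const_mul (k : ℤ) (c : ℂ) (g : ℝ → ℂ) (w : ℂ) :
    latticeSum k (fun x => c * g x) w = c * latticeSum k g w := by
  simp only [latticeSum, latticeTerm, ← tsum_mul_left, mul_left_comm]

lemma conj_linForm_zpow {p : ℤ × ℤ} (hp : p ≠ 0) {w : ℂ} (hw : 0 < w.im) (k : ℤ) :
    conj (linForm p w) ^ k = linForm p w ^ (-k) * ((quadForm p w : ℂ) * w.im) ^ k := by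
  have hl := linForm_ne_zero hp hw
  have hw' : (w.im : ℂ) ≠ 0 := by exact_mod_cast hw.ne'
  have hnorm : (quadForm p w : ℂ) * w.im = linForm p w * conj (linForm p w) := by
    rw [quadForm, mul_conj]
    push_cast
    field_simp
  rw [hnorm, mul_zpow, zpow_neg, inv_mul_cancel_left₀ (zpow_ne_zero _ hl)]

lemma conj_latticeSum (k : ℤ) (g : ℝ → ℂ) {w : ℂ} (hw : 0 < w.im) :
    conj (latticeSum k g w) =
      (w.im : ℂ) ^ (-k) * latticeSum (-k) (fun x => (x : ℂ) ^ (-k) * conj (g x)) w := by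
  simp only [latticeSum, conj_tsum, ← tsum_mul_left]
  refine tsum_congr fun p => ?_
  simp only [latticeTerm, map_mul, map_zpow₀, conj_linForm_zpow p.2 hw, mul_zpow]
  ring

end LatticeSum

section Derivative

/-- The real derivative of `quadForm p` at `w`. -/
def quadFormDeriv (p : ℤ × ℤ) (w : ℂ) : ℂ →L[ℝ] ℝ :=
  (-(w.im ^ 2)⁻¹) • (imCLM ∘L (conj (linForm p w) ^ 2 • ContinuousLinearMap.id ℝ ℂ))

/-- The real derivative at `w` of the term of index `p` of a lattice sum, where `g'` is the
derivative of `g`. -/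
def latticeTermDeriv (k : ℤ) (g g' : ℝ → ℂ) (p : ℤ × ℤ) (w : ℂ) : ℂ →L[ℝ] ℂ :=
  (g (quadForm p w) * ((-k : ℤ) * linForm p w ^ (-k - 1) * p.1)) • ContinuousLinearMap.id ℝ ℂ +
    (linForm p w ^ (-k) * g' (quadForm p w)) • (ofRealCLM ∘L quadFormDeriv p w)

/-- The real derivative at `w` of a lattice sum, where `g'` is the derivative of `g`. -/
def latticeSumDeriv (k : ℤ) (g g' : ℝ → ℂ) (w : ℂ) : ℂ →L[ℝ] ℂ :=
  ∑' p : NonzeroPair, latticeTermDeriv k g g' p w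

/-- Evaluation of real-linear maps at `v`, as a complex-linear map. -/
def evalCLM (v : ℂ) : (ℂ →L[ℝ] ℂ) →L[ℂ] ℂ :=
  LinearMap.mkContinuous ⟨⟨fun D => D v, fun _ _ => rfl⟩, fun _ _ => rfl⟩ ‖v‖ fun D => by
    simpa [mul_comm] using D.le_opNorm v

/-- The antilinear part of a real-linear map, evaluated at `1`: the Wirtinger derivative `∂f/∂z̄`
is the antilinear part of the real derivative of `f`. -/
def antilinearPart : (ℂ →L[ℝ] ℂ) →L[ℂ] ℂ := (1 / 2 : ℂ) • (evalCLM 1 + I • evalCLM I)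

lemma antilinearPart_apply (D : ℂ →L[ℝ] ℂ) : antilinearPart D = 1 / 2 * (D 1 + I * D I) := rfl

lemma hasDerivAt_linForm (p : ℤ × ℤ) (w : ℂ) : HasDerivAt (linForm p) p.1 w := by
  unfold linForm
  simpa using ((hasDerivAt_id w).const_mul (p.1 : ℂ)).add_const (p.2 : ℂ)

lemma hasFDerivAt_quadForm (p : ℤ × ℤ) {w : ℂ} (hw : 0 < w.im) :
    HasFDerivAt (quadForm p) (quadFormDeriv p w) w := by
  have hlin : HasFDerivAt (linForm p) ((p.1 : ℂ) • ContinuousLinearMap.id ℝ ℂ) w :=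
    ((hasDerivAt_linForm p w).hasFDerivAt.restrictScalars ℝ).congr_fderiv
      (by ext v; simp [mul_comm])
  have hre := reCLM.hasFDerivAt.comp w hlin
  have him := imCLM.hasFDerivAt.comp w hlin
  have hinv : HasFDerivAt (fun w : ℂ => (w.im)⁻¹) ((-(w.im ^ 2)⁻¹) • imCLM) w :=
    (hasDerivAt_inv hw.ne').comp_hasFDerivAt w imCLM.hasFDerivAt
  refine (((hre.mul hre).add (him.mul him)).mul hinv).congr_fderiv ?_
  ext v
  simp [quadFormDeriv, linForm, pow_two]
  field_simp
  ring

lemma norm_quadFormDeriv_le (p : ℤ × ℤ) {w : ℂ} (hw : 0 < w.im) :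
    ‖quadFormDeriv p w‖ ≤ quadForm p w / w.im := by
  have hcomp : ‖imCLM ∘L (conj (linForm p w) ^ 2 • ContinuousLinearMap.id ℝ ℂ)‖ ≤
      ‖linForm p w‖ ^ 2 := by
    refine (ContinuousLinearMap.opNorm_comp_le _ _).trans ?_
    simp [norm_smul]
  rw [quadFormDeriv, norm_smul, norm_neg, norm_inv, norm_pow, Real.norm_of_nonneg hw.le,
    quadForm, normSq_eq_norm_sq, div_div, ← pow_two, div_eq_inv_mul]
  gcongr

lemma abs_fst_le_norm_linForm_div (p : ℤ × ℤ) {w : ℂ} (hw : 0 < w.im) :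
    |(p.1 : ℝ)| ≤ ‖linForm p w‖ / w.im := by
  rw [le_div_iff₀ hw]
  simpa [linForm_im, abs_mul, abs_of_pos hw] using abs_im_le_norm (linForm p w)

lemma hasFDerivAt_latticeTerm (k : ℤ) {g g' : ℝ → ℂ}
    (hg : ∀ x, 0 < x → HasDerivAt g (g' x) x) {p : ℤ × ℤ} (hp : p ≠ 0) {w : ℂ} (hw : 0 < w.im) :
    HasFDerivAt (latticeTerm k g p) (latticeTermDeriv k g g' p w) w := by
  have hpow : HasDerivAt (fun w => linForm p w ^ (-k))
      ((-k : ℤ) * linForm p w ^ (-k - 1) * p.1) w :=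
    (hasDerivAt_zpow (-k) _ (Or.inl (linForm_ne_zero hp hw))).comp w (hasDerivAt_linForm p w)
  have hprofile := (hg _ (quadForm_pos hp hw)).hasFDerivAt.comp w (hasFDerivAt_quadForm p hw)
  refine ((hpow.hasFDerivAt.restrictScalars ℝ).mul hprofile).congr_fderiv ?_
  ext v
  simp [latticeTermDeriv]
  ring

lemma norm_latticeTermDeriv_le (k : ℤ) {A C : ℝ} {g g' : ℝ → ℂ} (h : IsDecayingProfile A C g g')
    {p : ℤ × ℤ} (hp : p ≠ 0) {w : ℂ} (hw : 0 < w.im) :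
    ‖latticeTermDeriv k g g' p w‖ ≤
      C * ((|(k : ℝ)| + 1) / w.im) * (‖linForm p w ^ (-k)‖ * quadForm p w ^ (-A)) := by
  have hl := linForm_ne_zero hp hw
  have hq := quadForm_pos hp hw
  have hC := h.nonneg
  have hpow : ‖((-k : ℤ) * linForm p w ^ (-k - 1) * p.1 : ℂ)‖ ≤
      |(k : ℝ)| / w.im * ‖linForm p w ^ (-k)‖ := by
    rw [norm_mul, norm_mul, zpow_sub_one₀ hl, norm_mul, norm_inv, norm_intCast, norm_intCast,
      Int.cast_neg, abs_neg]
    calc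
      _ ≤ |(k : ℝ)| * (‖linForm p w ^ (-k)‖ * ‖linForm p w‖⁻¹) * (‖linForm p w‖ / w.im) := by
        gcongr
        exact abs_fst_le_norm_linForm_div p hw
      _ = _ := by
        have := norm_ne_zero_iff.2 hl
        field_simp
  have hquad : ‖ofRealCLM ∘L quadFormDeriv p w‖ ≤ quadForm p w / w.im := by
    refine (ContinuousLinearMap.opNorm_comp_le _ _).trans ?_
    simpa using norm_quadFormDeriv_le p hw
  calc
    _ ≤ ‖g (quadForm p w)‖ * ‖((-k : ℤ) * linForm p w ^ (-k - 1) * p.1 : ℂ)‖ +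
        ‖linForm p w ^ (-k)‖ * ‖g' (quadForm p w)‖ * ‖ofRealCLM ∘L quadFormDeriv p w‖ := by
      refine (norm_add_le _ _).trans (add_le_add ?_ ?_) <;> simp [norm_smul]
    _ ≤ C * quadForm p w ^ (-A) * (|(k : ℝ)| / w.im * ‖linForm p w ^ (-k)‖) +
        ‖linForm p w ^ (-k)‖ * (C * quadForm p w ^ (-A - 1)) * (quadForm p w / w.im) := by
      gcongr
      exacts [h.norm_le _ hq, h.norm_deriv_le _ hq]
    _ = _ := by
      rw [Real.rpow_sub_one hq.ne']
      field_simp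

lemma exists_summable_bound_latticeTerm {k : ℤ} {A : ℝ} (hkA : 2 < 2 * A + k) {z : ℂ}
    (hz : 0 < z.im) :
    ∃ u : NonzeroPair → ℝ, Summable u ∧ ∀ (C : ℝ) (g g' : ℝ → ℂ), IsDecayingProfile A C g g' →
      ∀ w ∈ Metric.ball z (z.im / 2), ∀ p : NonzeroPair,
        ‖latticeTerm k g p w‖ ≤ C * u p ∧ ‖latticeTermDeriv k g g' p w‖ ≤ C * u p := by
  obtain ⟨u, hu, hbound⟩ := exists_summable_bound_linForm_quadForm hkA hz
  set c := (|(k : ℝ)| + 1) / (z.im / 2)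
  refine ⟨fun p => (1 + c) * u p, hu.mul_left _, fun C g g' h w hw p => ?_⟩
  obtain ⟨hlow, -, hw0⟩ := im_bounds_of_mem_ball hw
  have hC := h.nonneg
  have hp := hbound w hw p
  have hq := (quadForm_pos p.2 hw0).le
  have hu0 : 0 ≤ u p := le_trans (by positivity) hp
  constructor
  · calc
      _ ≤ C * u p := (norm_latticeTerm_le h.norm_le p.2 hw0).trans (by gcongr)
      _ ≤ C * ((1 + c) * u p) := by
        gcongr
        exact le_mul_of_one_le_left hu0 (le_add_of_nonneg_right (by positivity))
  · calc
      _ ≤ C * ((|(k : ℝ)| + 1) / w.im) * u p :=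
        (norm_latticeTermDeriv_le k h p.2 hw0).trans (by gcongr)
      _ ≤ C * (1 + c) * u p := by
        gcongr
        exact le_add_of_nonneg_of_le zero_le_one
          (div_le_div_of_nonneg_left (by positivity) (by positivity) hlow.le)
      _ = _ := mul_assoc _ _ _

lemma hasFDerivAt_latticeSum {k : ℤ} {A C : ℝ} (hkA : 2 < 2 * A + k) {g g' : ℝ → ℂ}
    (h : IsDecayingProfile A C g g') {z : ℂ} (hz : 0 < z.im) :
    HasFDerivAt (latticeSum k g) (latticeSumDeriv k g g' z) z := by
  obtain ⟨u, hu, hbound⟩ := exists_summable_bound_latticeTerm hkA hz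
  have hz' : z ∈ Metric.ball z (z.im / 2) := Metric.mem_ball_self (by positivity)
  exact hasFDerivAt_tsum_of_isPreconnected (hu.mul_left C) Metric.isOpen_ball
    (convex_ball z _).isPreconnected
    (fun p w hw => hasFDerivAt_latticeTerm k h.hasDerivAt p.2 (im_bounds_of_mem_ball hw).2.2)
    (fun p w hw => (hbound C g g' h w hw p).2) hz' (summable_latticeTerm hkA h.norm_le hz) hz'

lemma exists_norm_latticeSum_le {k : ℤ} {A : ℝ} (hkA : 2 < 2 * A + k) {z : ℂ} (hz : 0 < z.im) :
    ∃ M : ℝ, ∀ (C : ℝ) (g g' : ℝ → ℂ), IsDecayingProfile A C g g' →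
      ∀ w ∈ Metric.ball z (z.im / 2),
        ‖latticeSum k g w‖ ≤ C * M ∧ ‖latticeSumDeriv k g g' w‖ ≤ C * M := by
  obtain ⟨u, hu, hbound⟩ := exists_summable_bound_latticeTerm hkA hz
  refine ⟨∑' p, u p, fun C g g' h w hw => ?_⟩
  have hsum := hu.hasSum.mul_left C
  exact ⟨tsum_of_norm_bounded hsum fun p => (hbound C g g' h w hw p).1,
    tsum_of_norm_bounded hsum fun p => (hbound C g g' h w hw p).2⟩

lemma continuousOn_latticeSum {k : ℤ} {A C : ℝ} (hkA : 2 < 2 * A + k) {g g' : ℝ → ℝ → ℂ}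
    {s : Set ℝ} (h : ∀ t ∈ s, IsDecayingProfile A C (g t) (g' t))
    (hg : ∀ x, ContinuousOn (fun t => g t x) s) (hg' : ∀ x, ContinuousOn (fun t => g' t x) s)
    {z : ℂ} (hz : 0 < z.im) :
    ContinuousOn (fun t => latticeSum k (g t) z) s ∧
      ContinuousOn (fun t => latticeSumDeriv k (g t) (g' t) z) s := by
  obtain ⟨u, hu, hbound⟩ := exists_summable_bound_latticeTerm hkA hz
  have hz' : z ∈ Metric.ball z (z.im / 2) := Metric.mem_ball_self (by positivity)
  constructor
  · refine continuousOn_tsum (fun p => ?_) (hu.mul_left C)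
      fun p t ht => (hbound C _ _ (h t ht) z hz' p).1
    exact (hg _).const_mul _
  · refine continuousOn_tsum (fun p => ?_) (hu.mul_left C)
      fun p t ht => (hbound C _ _ (h t ht) z hz' p).2
    exact (((hg _).mul continuousOn_const).smul continuousOn_const).add
      ((continuousOn_const.mul (hg' _)).smul continuousOn_const)

lemma antilinearPart_latticeTermDeriv (k : ℤ) (g g' : ℝ → ℂ) {p : ℤ × ℤ} (hp : p ≠ 0) {w : ℂ}
    (hw : 0 < w.im) :
    antilinearPart (latticeTermDeriv k g g' p w) =
      -I / (2 * (w.im : ℂ) ^ 2) * latticeTerm (k - 2) g' p w := by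
  have hquad : ((quadFormDeriv p w 1 : ℝ) : ℂ) + I * (quadFormDeriv p w I : ℝ) =
      -I / (w.im : ℂ) ^ 2 * linForm p w ^ 2 := by
    have hconj : linForm p w ^ 2 = conj (conj (linForm p w) ^ 2) := by simp
    rw [hconj, quadFormDeriv]
    generalize conj (linForm p w) ^ 2 = v
    apply Complex.ext <;> simp [div_eq_mul_inv, ← ofReal_pow, ← ofReal_inv]
  have hpow : linForm p w ^ (-(k - 2)) = linForm p w ^ (-k) * linForm p w ^ 2 := by
    rw [← zpow_natCast, ← zpow_add₀ (linForm_ne_zero hp hw)]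
    ring_nf
  simp only [antilinearPart_apply, latticeTermDeriv, latticeTerm, hpow, add_apply, smul_apply,
    ContinuousLinearMap.comp_apply, ContinuousLinearMap.id_apply, ofRealCLM_apply, smul_eq_mul]
  linear_combination (linForm p w ^ (-k) * g' (quadForm p w)) / 2 * hquad +
    (g (quadForm p w) * ((-k : ℤ) * linForm p w ^ (-k - 1) * p.1)) / 2 * I_sq

lemma antilinearPart_latticeSumDeriv {k : ℤ} {A C : ℝ} (hkA : 2 < 2 * A + k) {g g' : ℝ → ℂ}
    (h : IsDecayingProfile A C g g') {z : ℂ} (hz : 0 < z.im) :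
    antilinearPart (latticeSumDeriv k g g' z) =
      -I / (2 * (z.im : ℂ) ^ 2) * latticeSum (k - 2) g' z := by
  obtain ⟨u, hu, hbound⟩ := exists_summable_bound_latticeTerm hkA hz
  have hsum : Summable fun p : NonzeroPair => latticeTermDeriv k g g' p z :=
    (hu.mul_left C).of_norm_bounded fun p =>
      (hbound C g g' h z (Metric.mem_ball_self (by positivity)) p).2
  rw [latticeSumDeriv, antilinearPart.map_tsum hsum, latticeSum, ← tsum_mul_left]
  exact tsum_congr fun p => antilinearPart_latticeTermDeriv k g g' p.2 hz

end Derivative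

section Theta

/-- The radial profile `xⁿ exp(-π x t)` of the theta functions. -/
def thetaProfile (n : ℕ) (t x : ℝ) : ℂ := (x : ℂ) ^ n * Real.exp (-Real.pi * x * t)

/-- The derivative of `thetaProfile n t`. -/
def thetaProfileDeriv (n : ℕ) (t x : ℝ) : ℂ :=
  (n * (x : ℂ) ^ (n - 1) - Real.pi * t * (x : ℂ) ^ n) * Real.exp (-Real.pi * x * t)

/-- The theta function of weight `k` of the lattice `ℤ z + ℤ`, with its zeroth term removed.
The harmonic factor `(m z + n)⁻ᵏ` becomes `conj (m z + n) ^ k`, up to a power of `Im z`, when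
`k > 0`, which is what the factor `x ^ k.toNat` is for. -/
def thetaTail (k : ℤ) (t : ℝ) (w : ℂ) : ℂ := latticeSum k (thetaProfile k.toNat t) w

/-- The real derivative of `thetaTail k t` at `w`. -/
def thetaTailDeriv (k : ℤ) (t : ℝ) (w : ℂ) : ℂ →L[ℝ] ℂ :=
  latticeSumDeriv k (thetaProfile k.toNat t) (thetaProfileDeriv k.toNat t) w

/-- The zeroth term of the theta function of weight `k`. -/
def thetaConst (k : ℤ) : ℂ := if k = 0 then 1 else 0

lemma pow_mul_exp_neg_pi_mul_le (m : ℕ) {x t : ℝ} (hx : 0 < x) (ht : 0 < t) :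
    x ^ m * Real.exp (-Real.pi * x * t) ≤ m.factorial * (t ^ m)⁻¹ := by
  have hexp : Real.exp (-Real.pi * x * t) ≤ (Real.exp (x * t))⁻¹ := by
    rw [← Real.exp_neg, Real.exp_le_exp]
    nlinarith [Real.pi_gt_three, mul_pos hx ht]
  have hpow := (div_le_iff₀' (by positivity)).1
    (Real.pow_div_factorial_le_exp (x * t) (by positivity) m)
  calc
    _ ≤ x ^ m * (Real.exp (x * t))⁻¹ := by gcongr
    _ ≤ m.factorial * (t ^ m)⁻¹ := by
      rw [← div_eq_mul_inv, ← div_eq_mul_inv, div_le_div_iff₀ (by positivity) (by positivity),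
        ← mul_pow]
      exact hpow

lemma hasDerivAt_thetaProfile (n : ℕ) (t x : ℝ) :
    HasDerivAt (thetaProfile n t) (thetaProfileDeriv n t x) x := by
  have hexp : HasDerivAt (fun x : ℝ => Real.exp (-Real.pi * x * t))
      (Real.exp (-Real.pi * x * t) * (-Real.pi * t)) x := by
    simpa using (((hasDerivAt_id x).const_mul (-Real.pi)).mul_const t).exp
  refine ((hasDerivAt_id x).ofReal_comp.pow n |>.mul hexp.ofReal_comp).congr_deriv ?_
  simp [thetaProfileDeriv]
  ring

lemma norm_thetaProfile_le (n N : ℕ) {x t : ℝ} (hx : 0 < x) (ht : 0 < t) :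
    ‖thetaProfile n t x‖ ≤ (n + N).factorial * (t ^ (n + N))⁻¹ * x ^ (-N : ℝ) := by
  rw [Real.rpow_neg hx.le, Real.rpow_natCast, ← div_eq_mul_inv, le_div_iff₀ (by positivity)]
  refine (le_of_eq ?_).trans (pow_mul_exp_neg_pi_mul_le (n + N) hx ht)
  rw [thetaProfile, norm_mul, norm_pow, norm_real, norm_real,
    Real.norm_of_nonneg (Real.exp_pos _).le, Real.norm_of_nonneg hx.le]
  ring

lemma norm_thetaProfileDeriv_le (n N : ℕ) {x t : ℝ} (hx : 0 < x) (ht : 0 < t) :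
    ‖thetaProfileDeriv n t x‖ ≤
      (n + 4) * (n + N + 1).factorial * (t ^ (n + N))⁻¹ * x ^ (-N - 1 : ℝ) := by
  rw [← neg_add', Real.rpow_neg hx.le, ← Nat.cast_succ, Real.rpow_natCast, ← div_eq_mul_inv,
    le_div_iff₀ (by positivity)]
  have hnorm : ‖thetaProfileDeriv n t x‖ ≤
      (n * x ^ (n - 1) + Real.pi * t * x ^ n) * Real.exp (-Real.pi * x * t) := by
    rw [thetaProfileDeriv, norm_mul, norm_real, Real.norm_of_nonneg (Real.exp_pos _).le]
    gcongr
    refine (norm_sub_le _ _).trans (le_of_eq ?_)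
    simp [abs_of_pos hx, abs_of_pos ht, abs_of_pos Real.pi_pos]
  have hpow : (n : ℝ) * x ^ (n - 1) * x = n * x ^ n := by
    cases n <;> simp [pow_succ, mul_assoc]
  have hfirst := pow_mul_exp_neg_pi_mul_le (n + N) hx ht
  have hsecond := pow_mul_exp_neg_pi_mul_le (n + N + 1) hx ht
  have hfact : ((n + N).factorial : ℝ) ≤ (n + N + 1).factorial := by
    exact_mod_cast Nat.factorial_le (Nat.le_succ _)
  calc
    _ ≤ (n * x ^ (n - 1) + Real.pi * t * x ^ n) * Real.exp (-Real.pi * x * t) * x ^ (N + 1) := by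
      gcongr
    _ = n * (x ^ (n + N) * Real.exp (-Real.pi * x * t)) +
        Real.pi * t * (x ^ (n + N + 1) * Real.exp (-Real.pi * x * t)) := by
      linear_combination x ^ N * Real.exp (-Real.pi * x * t) * hpow
    _ ≤ n * ((n + N).factorial * (t ^ (n + N))⁻¹) +
        4 * t * ((n + N + 1).factorial * (t ^ (n + N + 1))⁻¹) := by
      refine add_le_add (mul_le_mul_of_nonneg_left hfirst n.cast_nonneg)
        (mul_le_mul ?_ hsecond (by positivity) (by positivity))
      exact mul_le_mul_of_nonneg_right Real.pi_le_four ht.le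
    _ = (n * (n + N).factorial + 4 * (n + N + 1).factorial) * (t ^ (n + N))⁻¹ := by
      rw [pow_succ]
      field_simp
    _ ≤ _ := by
      rw [add_mul (n : ℝ) 4]
      gcongr

lemma isDecayingProfile_thetaProfile (n N : ℕ) {t : ℝ} (ht : 0 < t) :
    IsDecayingProfile N ((n + 4) * (n + N + 1).factorial * (t ^ (n + N))⁻¹)
      (thetaProfile n t) (thetaProfileDeriv n t) where
  hasDerivAt x _ := hasDerivAt_thetaProfile n t x
  norm_le x hx := by
    refine (norm_thetaProfile_le n N hx ht).trans ?_
    gcongr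
    calc
      ((n + N).factorial : ℝ) ≤ (n + N + 1).factorial := by
        exact_mod_cast Nat.factorial_le (Nat.le_succ _)
      _ ≤ (n + 4) * (n + N + 1).factorial :=
        le_mul_of_one_le_left (by positivity) (by linarith [n.cast_nonneg (α := ℝ)])
  norm_deriv_le x hx := norm_thetaProfileDeriv_le n N hx ht

/-- An exponent for which every lattice sum of weight `k` with decaying profile converges. -/
def convergenceExponent (k : ℤ) : ℕ := k.natAbs + 2

lemma two_lt_convergenceExponent {k : ℤ} {N : ℕ} (hN : convergenceExponent k ≤ N) :
    (2 : ℝ) < 2 * (N : ℝ) + k := by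
  unfold convergenceExponent at hN
  exact_mod_cast (by omega : (2 : ℤ) < 2 * N + k)

lemma summable_latticeTerm_thetaProfile (k : ℤ) (n : ℕ) {t : ℝ} (ht : 0 < t) {w : ℂ}
    (hw : 0 < w.im) :
    Summable fun p : NonzeroPair => latticeTerm k (thetaProfile n t) p w :=
  summable_latticeTerm (two_lt_convergenceExponent le_rfl)
    (isDecayingProfile_thetaProfile n _ ht).norm_le hw

lemma hasFDerivAt_thetaTail (k : ℤ) {t : ℝ} (ht : 0 < t) {z : ℂ} (hz : 0 < z.im) :
    HasFDerivAt (thetaTail k t) (thetaTailDeriv k t z) z :=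
  hasFDerivAt_latticeSum (two_lt_convergenceExponent le_rfl)
    (isDecayingProfile_thetaProfile _ _ ht) hz

lemma IsDecayingProfile.mono {A C C' : ℝ} {g g' : ℝ → ℂ} (h : IsDecayingProfile A C g g')
    (hC : C ≤ C') : IsDecayingProfile A C' g g' where
  hasDerivAt := h.hasDerivAt
  norm_le x hx := (h.norm_le x hx).trans (by gcongr)
  norm_deriv_le x hx := (h.norm_deriv_le x hx).trans (by gcongr)

lemma continuousOn_thetaTail (k : ℤ) {z : ℂ} (hz : 0 < z.im) :
    ContinuousOn (fun t => thetaTail k t z) (Ici 1) ∧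
      ContinuousOn (fun t => thetaTailDeriv k t z) (Ici 1) := by
  refine continuousOn_latticeSum (two_lt_convergenceExponent le_rfl) (fun t ht =>
    (isDecayingProfile_thetaProfile k.toNat _ (one_pos.trans_le ht)).mono
      (mul_le_of_le_one_right (by positivity) (inv_le_one_of_one_le₀ (one_le_pow₀ ht))))
    (fun x => ?_) (fun x => ?_) hz
  · unfold thetaProfile
    fun_prop
  · unfold thetaProfileDeriv
    fun_prop

lemma exists_norm_thetaTail_le (k : ℤ) (N : ℕ) {z : ℂ} (hz : 0 < z.im) :
    ∃ C : ℝ, ∀ w ∈ Metric.ball z (z.im / 2), ∀ t : ℝ, 1 ≤ t →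
      ‖thetaTail k t w‖ ≤ C * (t ^ N)⁻¹ ∧ ‖thetaTailDeriv k t w‖ ≤ C * (t ^ N)⁻¹ := by
  set n := k.toNat
  set B := max N (convergenceExponent k)
  obtain ⟨M, hM⟩ :=
    exists_norm_latticeSum_le (two_lt_convergenceExponent (le_max_right N _)) hz (k := k)
  refine ⟨(n + 4) * (n + B + 1).factorial * M, fun w hw t ht => ?_⟩
  have hdecay := (isDecayingProfile_thetaProfile n B (one_pos.trans_le ht)).mono
    (C' := (n + 4) * (n + B + 1).factorial * (t ^ N)⁻¹) (by
      gcongr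
      exact (le_max_left N _).trans (Nat.le_add_left _ _))
  simpa only [thetaTail, thetaTailDeriv, mul_right_comm _ M] using hM _ _ _ hdecay w hw

lemma isRapidlyDecreasing_thetaTail (k : ℤ) {z : ℂ} (hz : 0 < z.im) :
    IsRapidlyDecreasing fun t => thetaTail k t z where
  continuousOn := (continuousOn_thetaTail k hz).1
  exists_norm_le N := (exists_norm_thetaTail_le k N hz).imp fun _ hC t ht =>
    (hC z (Metric.mem_ball_self (by positivity)) t ht).1

lemma isRapidlyDecreasing_thetaTailDeriv (k : ℤ) {z : ℂ} (hz : 0 < z.im) :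
    IsRapidlyDecreasing fun t => thetaTailDeriv k t z where
  continuousOn := (continuousOn_thetaTail k hz).2
  exists_norm_le N := (exists_norm_thetaTail_le k N hz).imp fun _ hC t ht =>
    (hC z (Metric.mem_ball_self (by positivity)) t ht).2

lemma hasFDerivAt_upperMellin_thetaTail (k : ℤ) (S : ℂ) {z : ℂ} (hz : 0 < z.im) :
    HasFDerivAt (fun w => upperMellin (fun t => thetaTail k t w) S)
      (upperMellin (fun t => thetaTailDeriv k t z) S) z := by
  refine hasFDerivAt_upperMellin (H' := fun w t => thetaTailDeriv k t w)
    (Metric.ball_mem_nhds z (half_pos hz))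
    (fun w hw => isRapidlyDecreasing_thetaTail k (im_bounds_of_mem_ball hw).2.2)
    (continuousOn_thetaTail k hz).2 (fun N => ?_) (fun w hw t ht => ?_) S
  · exact (exists_norm_thetaTail_le k N hz).imp fun _ hC w hw t ht => (hC w hw t ht).2
  · exact hasFDerivAt_thetaTail k (one_pos.trans_le ht) (im_bounds_of_mem_ball hw).2.2

end Theta

section FunctionalEquation

/-- The partial Fourier transform in the second variable, up to a power of `t / Im z`, of the
Gaussian `p ↦ exp(-π t |m z + n|² / Im z)`. -/
def fourierGaussian (t : ℝ) (z : ℂ) (p : ℤ × ℤ) : ℂ :=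
  cexp (-(Real.pi * t * z.im) * p.1 ^ 2) *
    cexp (-Real.pi * (z.im / t) * p.2 ^ 2 + 2 * Real.pi * (-I * p.1 * z.re) * p.2)

lemma fourierGaussian_inv_swap {t : ℝ} (ht : 0 < t) (z : ℂ) (p : ℤ × ℤ) :
    fourierGaussian t⁻¹ z p.swap = fourierGaussian t z p := by
  have ht' : (t : ℂ) ≠ 0 := by exact_mod_cast ht.ne'
  simp only [fourierGaussian, ← Complex.exp_add, Prod.fst_swap, Prod.snd_swap, ofReal_inv]
  congr 1
  field_simp
  ring

lemma summable_exp_neg_mul_sq {a : ℝ} (ha : 0 < a) :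
    Summable fun n : ℤ => Real.exp (-(Real.pi * a) * (n : ℝ) ^ 2) := by
  have him : 0 < (I * (a : ℂ)).im := by simpa using ha
  refine ((summable_jacobiTheta₂_term_iff 0 _).2 him).norm.congr fun n => ?_
  simp [norm_jacobiTheta₂_term, mul_assoc, mul_comm a]

lemma summable_fourierGaussian {t : ℝ} (ht : 0 < t) {z : ℂ} (hz : 0 < z.im) :
    Summable (fourierGaussian t z) := by
  refine ((summable_exp_neg_mul_sq (mul_pos ht hz)).mul_of_nonneg
    (summable_exp_neg_mul_sq (div_pos hz ht)) (fun _ => (Real.exp_pos _).le)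
    fun _ => (Real.exp_pos _).le).of_norm_bounded fun p => le_of_eq ?_
  rw [fourierGaussian, norm_mul, norm_exp, norm_exp]
  congr 2
  · simp [← ofReal_intCast, ← ofReal_pow, mul_assoc]
  · simp [← ofReal_intCast, ← ofReal_pow, ← ofReal_div]

lemma thetaProfile_quadForm (t : ℝ) (m n : ℤ) {z : ℂ} (hz : 0 < z.im) :
    thetaProfile 0 t (quadForm (m, n) z) =
      cexp (-(Real.pi * t * z.im) * m ^ 2) *
        cexp (-Real.pi / (z.im / t : ℝ) * (n + I * (-I * m * z.re)) ^ 2) := by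
  have hy : (z.im : ℂ) ≠ 0 := by exact_mod_cast hz.ne'
  have hquad : (quadForm (m, n) z : ℂ) = ((m * z.re + n) ^ 2 + (m * z.im) ^ 2) / z.im := by
    simp [quadForm, linForm, normSq_apply, pow_two]
  have hshift : (n + I * (-I * m * z.re) : ℂ) = m * z.re + n := by
    linear_combination -(m * z.re : ℂ) * I_sq
  rw [thetaProfile, pow_zero, one_mul, ofReal_exp, ← Complex.exp_add, hshift]
  congr 1
  push_cast
  rw [hquad]
  field_simp
  ring

lemma tsum_thetaProfile_quadForm_row {t : ℝ} (ht : 0 < t) {z : ℂ} (hz : 0 < z.im) (m : ℤ) :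
    ∑' n : ℤ, thetaProfile 0 t (quadForm (m, n) z) =
      √(z.im / t) * ∑' n : ℤ, fourierGaussian t z (m, n) := by
  have hyt : 0 < z.im / t := div_pos hz ht
  have hpoisson := Complex.tsum_exp_neg_quadratic (a := (z.im / t : ℝ)) (by simpa) (-I * m * z.re)
  have hroot : ((z.im / t : ℝ) : ℂ) ^ (1 / 2 : ℂ) = √(z.im / t) := by
    rw [Real.sqrt_eq_rpow, ofReal_cpow hyt.le]
    norm_num
  have hne : (√(z.im / t) : ℂ) ≠ 0 := by exact_mod_cast (Real.sqrt_pos.2 hyt).ne'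
  simp only [fourierGaussian, thetaProfile_quadForm t m _ hz, tsum_mul_left, ← ofReal_div,
    hpoisson, hroot]
  field_simp

lemma hasSum_thetaProfile_quadForm {t : ℝ} (ht : 0 < t) {z : ℂ} (hz : 0 < z.im) :
    HasSum (fun p : ℤ × ℤ => thetaProfile 0 t (quadForm p z)) (thetaTail 0 t z + 1) := by
  have hnonzero : HasSum (fun p : NonzeroPair => thetaProfile 0 t (quadForm p z))
      (thetaTail 0 t z) := by
    simpa only [thetaTail, latticeSum, latticeTerm, neg_zero, zpow_zero, one_mul,
      Int.toNat_zero] using (summable_latticeTerm_thetaProfile 0 0 ht hz).hasSum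
  have hzero : HasSum (fun p : ({0} : Set (ℤ × ℤ)) => thetaProfile 0 t (quadForm p z)) 1 := by
    simpa [thetaProfile, quadForm, linForm] using
      hasSum_unique fun p : ({0} : Set (ℤ × ℤ)) => thetaProfile 0 t (quadForm p z)
  rw [add_comm]
  exact hzero.add_compl hnonzero

lemma thetaTail_zero_add_one {t : ℝ} (ht : 0 < t) {z : ℂ} (hz : 0 < z.im) :
    thetaTail 0 t z + 1 = √(z.im / t) * ∑' p, fourierGaussian t z p := by
  have h := hasSum_thetaProfile_quadForm ht hz
  rw [← h.tsum_eq, h.summable.tsum_prod, (summable_fourierGaussian ht hz).tsum_prod,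
    ← tsum_mul_left]
  exact tsum_congr fun m => tsum_thetaProfile_quadForm_row ht hz m

lemma thetaTail_zero_inv {t : ℝ} (ht : 0 < t) {z : ℂ} (hz : 0 < z.im) :
    thetaTail 0 t⁻¹ z + 1 = t * (thetaTail 0 t z + 1) := by
  have hsqrt : √(z.im / t⁻¹) = t * √(z.im / t) := by
    have hsq : z.im / t⁻¹ = t ^ 2 * (z.im / t) := by field_simp
    rw [hsq, Real.sqrt_mul (sq_nonneg t), Real.sqrt_sq ht.le]
  rw [thetaTail_zero_add_one ht hz, thetaTail_zero_add_one (inv_pos.2 ht) hz, hsqrt, ofReal_mul,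
    mul_assoc, ← (Equiv.prodComm ℤ ℤ).tsum_eq]
  exact congrArg _ (congrArg _ (tsum_congr (fourierGaussian_inv_swap ht z)))

lemma antilinearPart_thetaTailDeriv {k : ℤ} (hk : k ≤ 0) {t : ℝ} (ht : 0 < t) {z : ℂ}
    (hz : 0 < z.im) :
    antilinearPart (thetaTailDeriv k t z) =
      I * Real.pi * t / (2 * (z.im : ℂ) ^ 2) * thetaTail (k - 2) t z := by
  have hprofile : thetaProfileDeriv 0 t = fun x => (-Real.pi * t) * thetaProfile 0 t x := by
    funext x
    simp [thetaProfile, thetaProfileDeriv]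
  rw [thetaTailDeriv, antilinearPart_latticeSumDeriv (two_lt_convergenceExponent le_rfl)
    (isDecayingProfile_thetaProfile _ _ ht) hz, thetaTail, Int.toNat_of_nonpos hk,
    Int.toNat_of_nonpos (by omega), hprofile, latticeSum_const_mul]
  ring

-- The antilinear derivative lowers the weight by `2`, which reduces weight `-2 n` to weight `0`.
lemma thetaTail_inv_of_nonpos (n : ℕ) {t : ℝ} (ht : 0 < t) {z : ℂ} (hz : 0 < z.im) :
    thetaTail (-(2 * n : ℕ)) t⁻¹ z + thetaConst (-(2 * n : ℕ)) =
      t ^ (2 * n + 1) * (thetaTail (-(2 * n : ℕ)) t z + thetaConst (-(2 * n : ℕ))) := by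
  induction n generalizing z with
  | zero => simpa [thetaConst] using thetaTail_zero_inv ht hz
  | succ n ih =>
    have ht' : (t : ℂ) ≠ 0 := by exact_mod_cast ht.ne'
    have hy : (z.im : ℂ) ≠ 0 := by exact_mod_cast hz.ne'
    have hpi : (Real.pi : ℂ) ≠ 0 := by exact_mod_cast Real.pi_ne_zero
    set k : ℤ := -(2 * n : ℕ) with hk
    have hstep : (-(2 * (n + 1) : ℕ) : ℤ) = k - 2 := by
      rw [hk]
      omega
    have hconst : thetaConst (k - 2) = 0 := if_neg (by omega)
    have hleft := (hasFDerivAt_thetaTail k (inv_pos.2 ht) hz).add_const (thetaConst k)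
    have hright := ((hasFDerivAt_thetaTail k ht hz).add_const (thetaConst k)).const_mul
      ((t : ℂ) ^ (2 * n + 1))
    have hev : (fun w => thetaTail k t⁻¹ w + thetaConst k) =ᶠ[𝓝 z]
        fun w => (t : ℂ) ^ (2 * n + 1) * (thetaTail k t w + thetaConst k) := by
      filter_upwards [(isOpen_lt continuous_const continuous_im).mem_nhds hz] with w hw
      exact ih hw
    have h := congrArg antilinearPart (hleft.unique (hright.congr_of_eventuallyEq hev))
    rw [antilinearPart.map_smul, antilinearPart_thetaTailDeriv (by omega) ht hz,
      antilinearPart_thetaTailDeriv (by omega) (inv_pos.2 ht) hz, smul_eq_mul, ofReal_inv] at h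
    rw [hstep, hconst, add_zero, add_zero]
    generalize thetaTail (k - 2) t⁻¹ z = T at h ⊢
    field_simp at h
    linear_combination h

lemma conj_thetaTail_neg {k : ℤ} (hk : 0 ≤ k) (t : ℝ) {z : ℂ} (hz : 0 < z.im) :
    conj (thetaTail (-k) t z) = (z.im : ℂ) ^ k * thetaTail k t z := by
  rw [thetaTail, conj_latticeSum _ _ hz, neg_neg, Int.toNat_of_nonpos (by omega), thetaTail]
  congr 2
  funext x
  rw [thetaProfile, thetaProfile, pow_zero, one_mul, conj_ofReal, ← zpow_natCast,
    Int.toNat_of_nonneg hk]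

theorem thetaTail_inv {k : ℤ} (hk : Even k) {t : ℝ} (ht : 0 < t) {z : ℂ} (hz : 0 < z.im) :
    thetaTail k t⁻¹ z + thetaConst k =
      t ^ (k.natAbs + 1) * (thetaTail k t z + thetaConst k) := by
  obtain ⟨n, hn⟩ := Int.natAbs_even.2 hk |>.two_dvd
  rw [hn]
  rcases le_or_gt k 0 with hk0 | hk0
  · have hkn : k = -(2 * n : ℕ) := by omega
    rw [hkn]
    exact thetaTail_inv_of_nonpos n ht hz
  · have hkn : (-(2 * n : ℕ) : ℤ) = -k := by omega
    have hzero : thetaConst k = 0 := if_neg hk0.ne'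
    have hzero' : thetaConst (-k) = 0 := if_neg (by omega)
    have hy : (z.im : ℂ) ^ k ≠ 0 := zpow_ne_zero _ (by exact_mod_cast hz.ne')
    have h := congrArg conj (thetaTail_inv_of_nonpos n ht hz)
    rw [hkn, hzero', add_zero, add_zero, map_mul, conj_thetaTail_neg hk0.le _ hz,
      conj_thetaTail_neg hk0.le _ hz, map_pow, conj_ofReal, mul_left_comm] at h
    rw [hzero, add_zero, add_zero]
    exact mul_left_cancel₀ hy h

end FunctionalEquation

section Continuation

/-- The completion of Riemann's splitting of a Mellin integral in weight `k`: up to a power of `π`,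
the sum of the upper Mellin integrals at `S = s + k⁺` and at its reflection `|k| + 1 - S`. It takes
values in a space `E` so as to apply to theta functions and to their derivatives alike. -/
def symmetrizedMellin {E : Type*} [NormedAddCommGroup E] [NormedSpace ℂ E] (k : ℤ) (h : ℝ → E)
    (s : ℂ) : E :=
  (1 / 2 * (Real.pi : ℂ) ^ ((k.natAbs : ℂ) / 2)) •
    (upperMellin h (s + k.toNat) + upperMellin h (k.natAbs + 1 - (s + k.toNat)))

/-- The entire part of the completed Eisenstein series of weight `k`. -/
def entirePart (k : ℤ) (s w : ℂ) : ℂ := symmetrizedMellin k (fun t => thetaTail k t w) s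

/-- The polar part of the completed Eisenstein series of weight `k`, which comes from the zeroth
term of the theta function. -/
def polarPart (k : ℤ) (s : ℂ) : ℂ := thetaConst k / 2 * (1 / (s - 1) - 1 / s)

lemma natAbs_cast_eq {R : Type*} [Ring R] (k : ℤ) : (k.natAbs : R) = 2 * k.toNat - k := by
  have h : (k.natAbs : ℤ) = 2 * k.toNat - k := by omega
  simpa only [Int.cast_natCast, Int.cast_sub, Int.cast_mul, Int.cast_ofNat] using
    congrArg (Int.cast : ℤ → R) h

lemma IsRapidlyDecreasing.differentiable_symmetrizedMellin {E : Type*} [NormedAddCommGroup E]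
    [NormedSpace ℂ E] {h : ℝ → E} (hh : IsRapidlyDecreasing h) (k : ℤ) :
    Differentiable ℂ (symmetrizedMellin k h) :=
  ((hh.differentiable_upperMellin.comp (differentiable_id.add_const _)).add
    (hh.differentiable_upperMellin.comp ((differentiable_id.add_const _).const_sub _))).const_smul _

lemma differentiable_entirePart (k : ℤ) {z : ℂ} (hz : 0 < z.im) :
    Differentiable ℂ fun s => entirePart k s z :=
  (isRapidlyDecreasing_thetaTail k hz).differentiable_symmetrizedMellin k

lemma symmetrizedMellin_one_sub {E : Type*} [NormedAddCommGroup E] [NormedSpace ℂ E] (k : ℤ)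
    (h : ℝ → E) (s : ℂ) : symmetrizedMellin k h (1 - k - s) = symmetrizedMellin k h s := by
  have hreflect : 1 - k - s + k.toNat = k.natAbs + 1 - (s + k.toNat) := by
    rw [natAbs_cast_eq]
    ring
  rw [symmetrizedMellin, hreflect, sub_sub_cancel, add_comm (upperMellin h _), ← symmetrizedMellin]

lemma hasFDerivAt_entirePart (k : ℤ) (s : ℂ) {z : ℂ} (hz : 0 < z.im) :
    HasFDerivAt (entirePart k s) (symmetrizedMellin k (fun t => thetaTailDeriv k t z) s) z :=
  ((hasFDerivAt_upperMellin_thetaTail k (s + k.toNat) hz).add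
    (hasFDerivAt_upperMellin_thetaTail k (k.natAbs + 1 - (s + k.toNat)) hz)).const_smul
      (1 / 2 * (Real.pi : ℂ) ^ ((k.natAbs : ℂ) / 2))

lemma eisensteinSeries_eq_latticeSum (k : ℤ) (z : ℍ) (s : ℂ) :
    eisensteinSeries k z s = 1 / 2 * latticeSum k (fun x => (x : ℂ) ^ (-s)) z := by
  rw [eisensteinSeries, latticeSum]
  congr 1
  refine tsum_congr fun p => ?_
  have hl := norm_pos_iff.2 (linForm_ne_zero p.2 z.im_pos)
  have hpow : (quadForm p z : ℂ) ^ (-s) = (z.im : ℂ) ^ s / (‖linForm p z‖ : ℂ) ^ (2 * s) := by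
    rw [quadForm, normSq_eq_norm_sq, UpperHalfPlane.coe_im, div_eq_mul_inv, ofReal_mul,
      mul_cpow_ofReal_nonneg (by positivity) (inv_pos.2 z.im_pos).le, ofReal_inv,
      inv_cpow _ _ (arg_ofReal_ne_pi z.im_pos.le), cpow_neg, cpow_neg, inv_inv, sq, ofReal_mul,
      mul_cpow_ofReal_nonneg hl.le hl.le, two_mul, cpow_add _ _ (by exact_mod_cast hl.ne')]
    ring
  rw [latticeTerm, hpow, zpow_neg, ← div_eq_inv_mul, div_div]
  rfl

lemma mellin_thetaTail {k : ℤ} {s : ℂ} (hs : 1 - (k : ℝ) / 2 < s.re) {z : ℂ} (hz : 0 < z.im) :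
    mellin (fun t => thetaTail k t z) (s + k.toNat) =
      (Real.pi : ℂ) ^ (-(s + k.toNat)) * Gamma (s + k.toNat) *
        latticeSum k (fun x => (x : ℂ) ^ (-s)) z := by
  set n := k.toNat
  have hn : (k : ℝ) ≤ n := by exact_mod_cast Int.self_le_toNat k
  have hre : (s + n).re = s.re + n := by simp
  have hsum : Summable fun p : NonzeroPair =>
      ‖linForm p z ^ (-k) * (quadForm p z : ℂ) ^ n‖ / quadForm p z ^ (s + n).re := by
    have hterm : Summable fun p : NonzeroPair => latticeTerm k (fun x => (x : ℂ) ^ (-s)) p z :=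
      summable_latticeTerm (A := s.re) (C := 1) (by linarith) (fun x hx => by
        rw [norm_cpow_eq_rpow_re_of_pos hx, neg_re, one_mul]) hz
    refine hterm.norm.congr fun p => ?_
    have hq := quadForm_pos p.2 hz
    rw [latticeTerm, norm_mul, norm_mul, norm_cpow_eq_rpow_re_of_pos hq, norm_pow, norm_real,
      Real.norm_of_nonneg hq.le, hre, Real.rpow_add_natCast hq.ne', neg_re, Real.rpow_neg hq.le]
    field_simp
  have h := hasSum_mellin_pi_mul (F := fun t => thetaTail k t z)
    (fun p => Or.inr (quadForm_pos p.2 hz))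
    (by rw [hre]; linarith [(n.cast_nonneg : (0 : ℝ) ≤ n)]) (fun t ht => ?_) hsum
  · rw [← h.tsum_eq, latticeSum, ← tsum_mul_left]
    refine tsum_congr fun p => ?_
    have hq : (quadForm p z : ℂ) ≠ 0 := by exact_mod_cast (quadForm_pos p.2 hz).ne'
    rw [latticeTerm, cpow_neg _ s, cpow_add _ _ hq, cpow_natCast]
    field_simp
  · simpa only [thetaTail, latticeSum, latticeTerm, thetaProfile, ← mul_assoc] using
      (summable_latticeTerm_thetaProfile k n ht hz).hasSum

theorem completedEisensteinSeries_eq {k : ℤ} (hk : Even k) (z : ℍ) {s : ℂ}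
    (hs : 1 - (k : ℝ) / 2 < s.re) :
    completedEisensteinSeries k z s = entirePart k s z + polarPart k s := by
  have hpi : (Real.pi : ℂ) ≠ 0 := by exact_mod_cast Real.pi_ne_zero
  have habs : ((|k| : ℤ) : ℂ) = 2 * k.toNat - k := by
    rw [← natAbs_cast_eq, ← Int.natCast_natAbs, Int.cast_natCast]
  have hgamma : s + (k : ℂ) / 2 + ((|k| : ℤ) : ℂ) / 2 = s + k.toNat := by
    rw [habs]
    ring
  have hpow : (Real.pi : ℂ) ^ (-(s + (k : ℂ) / 2)) =
      (Real.pi : ℂ) ^ ((k.natAbs : ℂ) / 2) * (Real.pi : ℂ) ^ (-(s + k.toNat)) := by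
    rw [← cpow_add _ _ hpi, natAbs_cast_eq]
    ring_nf
  have hsplit := mellin_eq_upperMellin_add (isRapidlyDecreasing_thetaTail k z.im_pos)
    (κ := k.natAbs + 1) (c := thetaConst k) (S := s + k.toNat)
    (fun t ht => by exact_mod_cast thetaTail_inv hk ht z.im_pos) fun hc => ?_
  · calc
      _ = 1 / 2 * (Real.pi : ℂ) ^ ((k.natAbs : ℂ) / 2) *
          mellin (fun t => thetaTail k t z) (s + k.toNat) := by
        rw [completedEisensteinSeries, hgamma, hpow, eisensteinSeries_eq_latticeSum,
          mellin_thetaTail hs z.im_pos]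
        ring
      _ = _ := by
        rw [hsplit, mul_add, entirePart, symmetrizedMellin, smul_eq_mul, polarPart]
        rcases eq_or_ne k 0 with rfl | hk0
        · norm_num
          ring
        · simp [thetaConst, hk0]
  · obtain rfl : k = 0 := by
      by_contra hk0
      exact hc (if_neg hk0)
    norm_num at hs ⊢
    exact ⟨by linarith, hs⟩

lemma toMeromorphicNFOn_univ_eq_of_eventuallyEq {F G : ℂ → ℂ} {s : ℂ} (hF : MeromorphicOn F univ)
    (hG : AnalyticAt ℂ G s) (h : F =ᶠ[𝓝[≠] s] G) : toMeromorphicNFOn F univ s = G s := by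
  rw [toMeromorphicNFOn_eq_toMeromorphicNFAt hF (mem_univ s),
    (toMeromorphicNFAt_eventuallyEq_nhds_congr h).eq_of_nhds,
    toMeromorphicNFAt_eq_self.2 hG.meromorphicNFAt]

lemma IsMeromorphicContinuation.unique {F G f : ℂ → ℂ} {σ : ℝ}
    (hF : IsMeromorphicContinuation F f σ) (hG : IsMeromorphicContinuation G f σ) : F = G := by
  funext s
  have hsub : MeromorphicOn (F - G) univ := hF.1.meromorphicOn.sub hG.1.meromorphicOn
  have hregion : meromorphicOrderAt (F - G) ((σ + 1 : ℝ) : ℂ) = ⊤ := by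
    refine meromorphicOrderAt_eq_top_iff.2 (Eventually.filter_mono nhdsWithin_le_nhds ?_)
    filter_upwards [(isOpen_lt continuous_const continuous_re).mem_nhds
      (by simp : σ < ((σ + 1 : ℝ) : ℂ).re)] with w hw
    rw [Pi.sub_apply, hF.2 w hw, hG.2 w hw, sub_self]
  have hs : meromorphicOrderAt (F - G) s = ⊤ := by
    by_contra h
    exact hsub.meromorphicOrderAt_ne_top_of_isPreconnected isPreconnected_univ (mem_univ s)
      (mem_univ _) h hregion
  exact (((hF.1 (mem_univ s)).eventuallyEq_nhdsNE_iff_eventuallyEq_nhds (hG.1 (mem_univ s))).1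
    ((meromorphicOrderAt_eq_top_iff.1 hs).mono fun _ => sub_eq_zero.1)).eq_of_nhds

lemma not_isEisensteinPole_of_ne_zero {k : ℤ} (hk : k ≠ 0) (s : ℂ) : ¬ IsEisensteinPole k s :=
  fun h => hk h.1

lemma ne_zero_and_ne_one_of_not_isEisensteinPole {s : ℂ} (hs : ¬ IsEisensteinPole 0 s) :
    s ≠ 0 ∧ s - 1 ≠ 0 :=
  ⟨fun h => hs ⟨rfl, Or.inl h⟩, fun h => hs ⟨rfl, Or.inr (sub_eq_zero.1 h)⟩⟩

lemma analyticAt_polarPart {k : ℤ} {s : ℂ} (hs : ¬ IsEisensteinPole k s) :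
    AnalyticAt ℂ (polarPart k) s := by
  unfold polarPart
  rcases eq_or_ne k 0 with rfl | hk
  · obtain ⟨hs0, hs1⟩ := ne_zero_and_ne_one_of_not_isEisensteinPole hs
    fun_prop (disch := assumption)
  · simp only [thetaConst, if_neg hk, zero_div, zero_mul]
    exact analyticAt_const

lemma analyticAt_entirePart_add_polarPart {k : ℤ} (z : ℍ) {s : ℂ} (hs : ¬ IsEisensteinPole k s) :
    AnalyticAt ℂ (fun s => entirePart k s z + polarPart k s) s :=
  ((differentiable_entirePart k z.im_pos).analyticAt s).add (analyticAt_polarPart hs)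

lemma meromorphicOn_entirePart_add_polarPart (k : ℤ) (z : ℍ) :
    MeromorphicOn (fun s => entirePart k s z + polarPart k s) univ := fun s _ =>
  ((differentiable_entirePart k z.im_pos).analyticAt s).meromorphicAt.add
    (by unfold polarPart; fun_prop)

lemma isMeromorphicContinuation_entirePart_add_polarPart {k : ℤ} (hk : Even k) (z : ℍ) :
    IsMeromorphicContinuation
      (toMeromorphicNFOn (fun s => entirePart k s z + polarPart k s) univ)
      (completedEisensteinSeries k z) (1 - (k : ℝ) / 2) := by
  refine ⟨meromorphicNFOn_toMeromorphicNFOn _ _, fun s hs => ?_⟩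
  rw [completedEisensteinSeries_eq hk z hs]
  refine toMeromorphicNFOn_univ_eq_of_eventuallyEq (meromorphicOn_entirePart_add_polarPart k z)
    (analyticAt_entirePart_add_polarPart z ?_) EventuallyEq.rfl
  rintro ⟨rfl, rfl | rfl⟩ <;> norm_num at hs

theorem isMeromorphicContinuation_completedEisenstein {k : ℤ} (hk : Even k) (z : ℍ) :
    IsMeromorphicContinuation (completedEisenstein k z) (completedEisensteinSeries k z)
      (1 - (k : ℝ) / 2) :=
  Classical.epsilon_spec (p := fun F => IsMeromorphicContinuation F _ _)
    ⟨_, isMeromorphicContinuation_entirePart_add_polarPart hk z⟩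

theorem completedEisenstein_eq {k : ℤ} (hk : Even k) (z : ℍ) {s : ℂ}
    (hs : ¬ IsEisensteinPole k s) :
    completedEisenstein k z s = entirePart k s z + polarPart k s := by
  rw [(isMeromorphicContinuation_completedEisenstein hk z).unique
    (isMeromorphicContinuation_entirePart_add_polarPart hk z)]
  exact toMeromorphicNFOn_univ_eq_of_eventuallyEq (meromorphicOn_entirePart_add_polarPart k z)
    (analyticAt_entirePart_add_polarPart z hs) EventuallyEq.rfl

lemma eventually_not_isEisensteinPole (k : ℤ) (s : ℂ) :
    ∀ᶠ t in 𝓝[≠] s, ¬ IsEisensteinPole k t := by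
  have hfinite : ({0, 1} : Set ℂ).Finite := toFinite _
  filter_upwards [nhdsNE_le_cofinite s hfinite.compl_mem_cofinite] with t ht hpole
  exact ht hpole.2

theorem analyticAt_completedEisenstein {k : ℤ} (hk : Even k) (z : ℍ) {s : ℂ}
    (hs : ¬ IsEisensteinPole k s) : AnalyticAt ℂ (completedEisenstein k z) s := by
  refine (analyticAt_entirePart_add_polarPart z hs).congr
    (eventuallyEq_nhds_of_eventuallyEq_nhdsNE ?_ (completedEisenstein_eq hk z hs).symm)
  filter_upwards [eventually_not_isEisensteinPole k s] with t ht
  exact (completedEisenstein_eq hk z ht).symm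

lemma differentiable_mul_entirePart_add_const (k : ℤ) (c : ℂ) {z : ℂ} (hz : 0 < z.im) :
    Differentiable ℂ fun s =>
      (s + (k : ℂ) / 2) * (s + (k : ℂ) / 2 - 1) * entirePart k s z + c :=
  ((by fun_prop : Differentiable ℂ fun s : ℂ => (s + (k : ℂ) / 2) * (s + (k : ℂ) / 2 - 1)).mul
    (differentiable_entirePart k hz)).add_const c

theorem doublyCompletedEisenstein_eq {k : ℤ} (hk : Even k) (z : ℍ) :
    doublyCompletedEisenstein k z = fun s =>
      (s + (k : ℂ) / 2) * (s + (k : ℂ) / 2 - 1) * entirePart k s z + thetaConst k / 2 := by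
  funext s
  refine toMeromorphicNFOn_univ_eq_of_eventuallyEq (fun t ht => ?_)
    ((differentiable_mul_entirePart_add_const k _ z.im_pos).analyticAt s) ?_
  · exact MeromorphicAt.mul (by fun_prop)
      ((isMeromorphicContinuation_completedEisenstein hk z).1.meromorphicOn t ht)
  · filter_upwards [eventually_not_isEisensteinPole k s] with t ht
    rw [completedEisenstein_eq hk z ht, polarPart]
    rcases eq_or_ne k 0 with rfl | hk0
    · obtain ⟨ht0, ht1⟩ := ne_zero_and_ne_one_of_not_isEisensteinPole ht
      simp only [Int.cast_zero, zero_div, add_zero]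
      field_simp
      ring
    · simp [thetaConst, hk0]

theorem differentiable_doublyCompletedEisenstein {k : ℤ} (hk : Even k) (z : ℍ) :
    Differentiable ℂ (doublyCompletedEisenstein k z) := by
  rw [doublyCompletedEisenstein_eq hk z]
  exact differentiable_mul_entirePart_add_const k _ z.im_pos

end Continuation

section Xi

lemma comp_ofComplex_eventuallyEq {f : ℍ → ℂ} {F : ℂ → ℂ} (hf : ∀ w : ℍ, f w = F w) (z : ℍ) :
    (fun w : ℂ => f (UpperHalfPlane.ofComplex w)) =ᶠ[𝓝 (z : ℂ)] F := by
  filter_upwards [UpperHalfPlane.eventuallyEq_coe_comp_ofComplex z.im_pos] with w hw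
  rw [hf]
  exact congrArg F hw

lemma realDifferentiableAt_of_hasFDerivAt {f : ℍ → ℂ} {F : ℂ → ℂ} (hf : ∀ w : ℍ, f w = F w)
    {z : ℍ} {D : ℂ →L[ℝ] ℂ} (hF : HasFDerivAt F D z) : RealDifferentiableAt f z :=
  hF.differentiableAt.congr_of_eventuallyEq (comp_ofComplex_eventuallyEq hf z)

lemma xi_eq_antilinearPart (k : ℤ) {f : ℍ → ℂ} {F : ℂ → ℂ} (hf : ∀ w : ℍ, f w = F w) {z : ℍ}
    {D : ℂ →L[ℝ] ℂ} (hF : HasFDerivAt F D z) :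
    xi k f z = 2 * I * (z.im : ℂ) ^ k * conj (antilinearPart D) := by
  rw [xi, wirtingerBar, (comp_ofComplex_eventuallyEq hf z).fderiv_eq, hF.fderiv,
    antilinearPart_apply]

lemma xi_add_const (k : ℤ) (f : ℍ → ℂ) (c : ℂ) (z : ℍ) :
    xi k (fun w => f w + c) z = xi k f z := by
  simp only [xi, wirtingerBar, fderiv_add_const]

lemma xi_const_mul (k : ℤ) (c : ℂ) (f : ℍ → ℂ) (z : ℍ) :
    xi k (fun w => c * f w) z = conj c * xi k f z := by
  have hfderiv := congrFun (fderiv_const_smul_field (𝕜 := ℝ)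
    (f := fun w : ℂ => f (UpperHalfPlane.ofComplex w)) c) z
  simp only [Pi.smul_def, smul_eq_mul] at hfderiv
  simp only [xi, wirtingerBar, hfderiv, smul_apply, smul_eq_mul, map_mul, map_add]
  ring

lemma conj_ofReal_cpow {x : ℝ} (hx : 0 ≤ x) (w : ℂ) :
    conj ((x : ℂ) ^ w) = (x : ℂ) ^ conj w := by
  rw [cpow_conj _ _ (arg_ofReal_ne_pi hx), conj_ofReal]

lemma xi_latticeSum {k : ℤ} {A C : ℝ} (hkA : 2 < 2 * A + k) {g g' : ℝ → ℂ}
    (h : IsDecayingProfile A C g g') (z : ℍ) :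
    xi k (fun w => latticeSum k g w) z =
      -latticeSum (2 - k) (fun x => (x : ℂ) ^ (2 - k) * conj (g' x)) z := by
  have hy : (z.im : ℂ) ≠ 0 := by exact_mod_cast z.im_pos.ne'
  rw [xi_eq_antilinearPart k (fun _ => rfl) (hasFDerivAt_latticeSum hkA h z.im_pos),
    antilinearPart_latticeSumDeriv hkA h z.im_pos]
  simp only [map_mul, map_div₀, map_neg, map_pow, conj_I, conj_ofReal, map_ofNat,
    conj_latticeSum _ _ z.im_pos, neg_sub, UpperHalfPlane.coe_im, zpow_sub₀ hy, zpow_ofNat]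
  field_simp
  linear_combination
    latticeSum (2 - k) (fun x => (x : ℂ) ^ (2 - k) * conj (g' x)) z * I_sq

lemma isDecayingProfile_cpow (s : ℂ) :
    IsDecayingProfile s.re (1 + ‖s‖) (fun x => (x : ℂ) ^ (-s))
      fun x => -s * (x : ℂ) ^ (-s - 1) where
  hasDerivAt x hx := by
    simpa using ((hasDerivAt_id (x : ℂ)).cpow_const (c := -s) (Or.inl hx)).comp_ofReal
  norm_le x hx := by
    rw [norm_cpow_eq_rpow_re_of_pos hx, neg_re]
    exact le_mul_of_one_le_left (by positivity) (le_add_of_nonneg_right (norm_nonneg s))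
  norm_deriv_le x hx := by
    rw [norm_mul, norm_neg, norm_cpow_eq_rpow_re_of_pos hx, sub_re, neg_re, one_re]
    gcongr
    exact le_add_of_nonneg_left zero_le_one

theorem xi_eisensteinSeries {k : ℤ} {s : ℂ} (hs : 1 - (k : ℝ) / 2 < s.re) (z : ℍ) :
    xi k (fun w => eisensteinSeries k w s) z =
      conj s * eisensteinSeries (2 - k) z (conj s + k - 1) := by
  have hks : 2 < 2 * s.re + k := by linarith
  have hprofile := isDecayingProfile_cpow s
  have hpow : ∀ x : ℝ, 0 < x → (x : ℂ) ^ (2 - k) * conj (-s * (x : ℂ) ^ (-s - 1)) =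
      -conj s * (x : ℂ) ^ (-(conj s + k - 1)) := fun x hx => by
    have hx' : (x : ℂ) ≠ 0 := by exact_mod_cast hx.ne'
    rw [map_mul, conj_ofReal_cpow hx.le, mul_left_comm, ← cpow_intCast, ← cpow_add _ _ hx',
      map_neg, map_sub, map_neg, map_one]
    push_cast
    ring_nf
  simp only [eisensteinSeries_eq_latticeSum]
  rw [xi_const_mul, xi_latticeSum hks hprofile, latticeSum_congr hpow z.im_pos,
    latticeSum_const_mul, map_div₀, map_one, map_ofNat]
  ring

/-- The factor `1` for `k ≤ 0` and `σ (σ + k - 1)` for `k > 0` by which `ξ_k` differs from mapping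
the completed series of weight `k` to that of weight `2 - k`; here `σ` stands for `conj s`. -/
def xiFactor (k : ℤ) (σ : ℂ) : ℂ := if k ≤ 0 then 1 else σ * (σ + k - 1)

lemma xiFactor_of_nonpos {k : ℤ} (hk : k ≤ 0) (σ : ℂ) : xiFactor k σ = 1 := if_pos hk

lemma xiFactor_of_pos {k : ℤ} (hk : 0 < k) (σ : ℂ) : xiFactor k σ = σ * (σ + k - 1) :=
  if_neg hk.not_ge

lemma Gamma_mul_eq_xiFactor_mul_Gamma {k : ℤ} (hk : Even k) {σ : ℂ}
    (hσ : 1 - (k : ℝ) / 2 < σ.re) :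
    Gamma (σ + (k : ℂ) / 2 + ((|k| : ℤ) : ℂ) / 2) * σ =
      xiFactor k σ * Gamma (σ + (k : ℂ) / 2 + ((|2 - k| : ℤ) : ℂ) / 2) := by
  rcases le_or_gt k 0 with hk0 | hk0
  · have hσ0 : σ ≠ 0 := by
      rintro rfl
      have : (k : ℝ) ≤ 0 := by exact_mod_cast hk0
      rw [zero_re] at hσ
      linarith
    rw [xiFactor_of_nonpos hk0, abs_of_nonpos hk0, abs_of_nonneg (by omega), one_mul, mul_comm]
    push_cast
    ring_nf
    rw [add_comm, Gamma_add_one σ hσ0]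
  · have hk2 : 2 ≤ k := by
      obtain ⟨n, rfl⟩ := hk
      omega
    have hσ1 : σ + k - 1 ≠ 0 := by
      intro h
      have hre : σ.re + k - 1 = 0 := by simpa using congrArg re h
      have : (2 : ℝ) ≤ k := by exact_mod_cast hk2
      linarith
    rw [xiFactor_of_pos hk0, abs_of_pos hk0, abs_of_nonpos (by omega)]
    have hleft : σ + (k : ℂ) / 2 + (k : ℂ) / 2 = σ + k - 1 + 1 := by ring
    have hright : σ + (k : ℂ) / 2 + ((-(2 - k) : ℤ) : ℂ) / 2 = σ + k - 1 := by
      push_cast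
      ring
    rw [hleft, hright, Gamma_add_one _ hσ1]
    ring

theorem xi_completedEisensteinSeries {k : ℤ} (hk : Even k) {s : ℂ}
    (hs : 1 - (k : ℝ) / 2 < s.re) (z : ℍ) :
    xi k (fun w => completedEisensteinSeries k w s) z =
      xiFactor k (conj s) * completedEisensteinSeries (2 - k) z (conj s + k - 1) := by
  have hpow : conj ((Real.pi : ℂ) ^ (-(s + (k : ℂ) / 2))) =
      (Real.pi : ℂ) ^ (-(conj s + (k : ℂ) / 2)) := by
    rw [conj_ofReal_cpow Real.pi_pos.le, map_neg, map_add, map_div₀, map_intCast, map_ofNat]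
  have hgamma : conj (Gamma (s + (k : ℂ) / 2 + ((|k| : ℤ) : ℂ) / 2)) =
      Gamma (conj s + (k : ℂ) / 2 + ((|k| : ℤ) : ℂ) / 2) := by
    simp only [← Gamma_conj, map_add, map_div₀, map_intCast, map_ofNat]
  have hshift : conj s + k - 1 + ((2 - k : ℤ) : ℂ) / 2 = conj s + (k : ℂ) / 2 := by
    push_cast
    ring
  simp only [completedEisensteinSeries]
  rw [xi_const_mul, xi_eisensteinSeries hs, map_mul, hpow, hgamma, hshift]
  linear_combination (Real.pi : ℂ) ^ (-(conj s + (k : ℂ) / 2)) *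
    eisensteinSeries (2 - k) z (conj s + k - 1) *
    Gamma_mul_eq_xiFactor_mul_Gamma hk (σ := conj s) (by rwa [conj_re])

lemma polarPart_one_sub (k : ℤ) (s : ℂ) : polarPart k (1 - k - s) = polarPart k s := by
  rcases eq_or_ne k 0 with rfl | hk
  · rw [polarPart, polarPart, Int.cast_zero, sub_zero, sub_sub_cancel_left, ← neg_sub s 1,
      one_div_neg_eq_neg_one_div, one_div_neg_eq_neg_one_div]
    ring
  · simp [polarPart, thetaConst, hk]

lemma xiFactor_mul_polarPart {k : ℤ} {σ : ℂ} (hσ : ¬ IsEisensteinPole (2 - k) (-σ)) :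
    xiFactor k σ * polarPart (2 - k) (-σ) = thetaConst (2 - k) / 2 := by
  rcases eq_or_ne k 2 with rfl | hk
  · rw [sub_self] at hσ ⊢
    obtain ⟨hσ0, hσ1⟩ := ne_zero_and_ne_one_of_not_isEisensteinPole hσ
    rw [neg_ne_zero] at hσ0
    rw [xiFactor_of_pos two_pos, polarPart]
    push_cast
    field_simp
    ring
  · simp [polarPart, thetaConst, sub_ne_zero.2 hk.symm]

lemma realDifferentiableAt_entirePart (k : ℤ) (s : ℂ) (z : ℍ) :
    RealDifferentiableAt (fun w => entirePart k s w) z :=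
  realDifferentiableAt_of_hasFDerivAt (fun _ => rfl) (hasFDerivAt_entirePart k s z.im_pos)

lemma xi_entirePart_of_lt_re {k : ℤ} (hk : Even k) {s : ℂ} (hs : 1 - (k : ℝ) / 2 < s.re) (z : ℍ) :
    xi k (fun w => entirePart k s w) z =
      xiFactor k (conj s) * entirePart (2 - k) (-conj s) z + thetaConst (2 - k) / 2 := by
  have hs' : 1 - ((2 - k : ℤ) : ℝ) / 2 < (conj s + k - 1).re := by
    simp only [sub_re, add_re, conj_re, intCast_re, one_re]
    push_cast
    linarith
  have hreflect : conj s + k - 1 = 1 - (2 - k : ℤ) - -conj s := by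
    push_cast
    ring
  have hpole : ¬ IsEisensteinPole (2 - k) (-conj s) := by
    rintro ⟨hk2, h⟩
    obtain rfl : k = 2 := by omega
    norm_num at hs
    rcases h with h | h
    · have hre : s.re = 0 := by simpa using congrArg re h
      exact hs.ne' hre
    · have hre : -s.re = 1 := by simpa using congrArg re h
      linarith only [hs, hre]
  have hxi := xi_completedEisensteinSeries hk hs z
  simp only [completedEisensteinSeries_eq hk _ hs] at hxi
  rwa [xi_add_const, completedEisensteinSeries_eq (even_two.sub hk) z hs', hreflect,
    polarPart_one_sub, entirePart, symmetrizedMellin_one_sub, ← entirePart, mul_add,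
    xiFactor_mul_polarPart hpole] at hxi

lemma eq_of_differentiable_of_forall_lt_re {f g : ℂ → ℂ} (hf : Differentiable ℂ f)
    (hg : Differentiable ℂ g) {σ : ℝ} (h : ∀ s : ℂ, σ < s.re → f s = g s) : f = g := by
  have hmem : {s : ℂ | σ < s.re} ∈ 𝓝 ((σ + 1 : ℝ) : ℂ) :=
    (isOpen_lt continuous_const continuous_re).mem_nhds (by simp)
  exact AnalyticOnNhd.eq_of_eventuallyEq (fun s _ => hf.analyticAt s) (fun s _ => hg.analyticAt s)
    (eventually_of_mem hmem h)

lemma differentiable_xi_entirePart_conj (k : ℤ) (z : ℍ) :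
    Differentiable ℂ fun σ => xi k (fun w => entirePart k (conj σ) w) z := by
  have hxi : ∀ s, xi k (fun w => entirePart k s w) z = 2 * I * (z.im : ℂ) ^ k *
      conj (antilinearPart (symmetrizedMellin k (fun t => thetaTailDeriv k t z) s)) := fun s =>
    xi_eq_antilinearPart k (fun _ => rfl) (hasFDerivAt_entirePart k s z.im_pos)
  simp only [hxi]
  have hderiv := antilinearPart.differentiable.comp
    ((isRapidlyDecreasing_thetaTailDeriv k z.im_pos).differentiable_symmetrizedMellin k)
  exact Differentiable.const_mul (fun σ => differentiableAt_conj_conj_iff.2 (hderiv (conj σ))) _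

lemma differentiable_xiFactor (k : ℤ) : Differentiable ℂ (xiFactor k) := by
  unfold xiFactor
  split_ifs <;> fun_prop

lemma differentiable_xiFactor_mul_entirePart_neg (k : ℤ) (z : ℍ) :
    Differentiable ℂ fun σ =>
      xiFactor k σ * entirePart (2 - k) (-σ) z + thetaConst (2 - k) / 2 :=
  ((differentiable_xiFactor k).mul
    ((differentiable_entirePart (2 - k) z.im_pos).comp differentiable_neg)).add_const _

theorem xi_entirePart {k : ℤ} (hk : Even k) (s : ℂ) (z : ℍ) :
    xi k (fun w => entirePart k s w) z =
      xiFactor k (conj s) * entirePart (2 - k) (-conj s) z + thetaConst (2 - k) / 2 := by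
  have h := eq_of_differentiable_of_forall_lt_re (differentiable_xi_entirePart_conj k z)
    (differentiable_xiFactor_mul_entirePart_neg k z) (σ := 1 - (k : ℝ) / 2) fun σ hσ => by
      rw [xi_entirePart_of_lt_re hk (by rwa [conj_re]), conj_conj]
  simpa only [conj_conj] using congrFun h (conj s)

theorem realDifferentiableAt_completedEisenstein {k : ℤ} (hk : Even k) {s : ℂ}
    (hs : ¬ IsEisensteinPole k s) (z : ℍ) :
    RealDifferentiableAt (fun w => completedEisenstein k w s) z := by
  simp only [completedEisenstein_eq hk _ hs]
  exact DifferentiableAt.add_const _ (realDifferentiableAt_entirePart k s z)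

theorem realDifferentiableAt_doublyCompletedEisenstein {k : ℤ} (hk : Even k) (s : ℂ) (z : ℍ) :
    RealDifferentiableAt (fun w => doublyCompletedEisenstein k w s) z := by
  simp only [doublyCompletedEisenstein_eq hk]
  exact ((realDifferentiableAt_entirePart k s z).const_mul _).add_const _

lemma xi_completedEisenstein_eq_entirePart {k : ℤ} (hk : Even k) {s : ℂ}
    (hs : ¬ IsEisensteinPole k s) (z : ℍ) :
    xi k (fun w => completedEisenstein k w s) z =
      xiFactor k (conj s) * entirePart (2 - k) (-conj s) z + thetaConst (2 - k) / 2 := by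
  simp only [completedEisenstein_eq hk _ hs]
  rw [xi_add_const, xi_entirePart hk]

lemma xiFactor_mul_completedEisenstein {k : ℤ} (hk : Even k) (z : ℍ) {σ : ℂ}
    (hσ : ¬ IsEisensteinPole (2 - k) (-σ)) :
    xiFactor k σ * completedEisenstein (2 - k) z (-σ) =
      xiFactor k σ * entirePart (2 - k) (-σ) z + thetaConst (2 - k) / 2 := by
  rw [completedEisenstein_eq (even_two.sub hk) z hσ, mul_add, xiFactor_mul_polarPart hσ]

theorem xi_completedEisenstein {k : ℤ} (hk : Even k) {s : ℂ} (hs : ¬ IsEisensteinPole k s)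
    (hs' : ¬ IsEisensteinPole (2 - k) (-conj s)) (z : ℍ) :
    xi k (fun w => completedEisenstein k w s) z =
      xiFactor k (conj s) * completedEisenstein (2 - k) z (-conj s) := by
  rw [xi_completedEisenstein_eq_entirePart hk hs, xiFactor_mul_completedEisenstein hk z hs']

theorem tendsto_xiFactor_mul_completedEisenstein {k : ℤ} (hk : Even k) {s : ℂ}
    (hs : ¬ IsEisensteinPole k s) (z : ℍ) :
    Tendsto (fun t => xiFactor k (conj t) * completedEisenstein (2 - k) z (-conj t)) (𝓝[≠] s)
      (𝓝 (xi k (fun w => completedEisenstein k w s) z)) := by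
  have hcont := (differentiable_xiFactor_mul_entirePart_neg k z).continuous.comp continuous_conj
  have hreflect : Tendsto (fun t : ℂ => -conj t) (𝓝[≠] s) (𝓝[≠] (-conj s)) :=
    continuous_conj.neg.continuousWithinAt.tendsto_nhdsWithin fun _ ht =>
      (neg_injective.comp (starRingEnd ℂ).injective).ne ht
  rw [xi_completedEisenstein_eq_entirePart hk hs]
  refine (hcont.tendsto s |>.mono_left nhdsWithin_le_nhds).congr' ?_
  filter_upwards [hreflect.eventually (eventually_not_isEisensteinPole (2 - k) _)] with t ht
  exact (xiFactor_mul_completedEisenstein hk z ht).symm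

lemma mul_thetaConst_eq_xiFactor_mul_thetaConst (k : ℤ) (σ : ℂ) :
    (σ + (k : ℂ) / 2) * (σ + (k : ℂ) / 2 - 1) * thetaConst (2 - k) =
      xiFactor k σ * thetaConst (2 - k) := by
  rcases eq_or_ne k 2 with rfl | hk
  · rw [xiFactor_of_pos two_pos]
    push_cast
    ring
  · simp [thetaConst, sub_ne_zero.2 hk.symm]

theorem xi_doublyCompletedEisenstein {k : ℤ} (hk : Even k) (s : ℂ) (z : ℍ) :
    xi k (fun w => doublyCompletedEisenstein k w s) z =
      xiFactor k (conj s) * doublyCompletedEisenstein (2 - k) z (-conj s) := by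
  simp only [doublyCompletedEisenstein_eq hk, doublyCompletedEisenstein_eq (even_two.sub hk)]
  rw [xi_add_const, xi_const_mul, xi_entirePart hk]
  simp only [map_mul, map_sub, map_add, map_div₀, map_intCast, map_one, map_ofNat, Int.cast_sub,
    Int.cast_ofNat]
  linear_combination mul_thetaConst_eq_xiFactor_mul_thetaConst k (conj s) / 2

end Xi

end PolyharmonicMaass

end

theorem mainTheorem10 (k : ℤ) (hk : Even k) :
    -- the series have continuations, and `ξ_k` is applied to differentiable functions
    (∀ z : ℍ,
      PolyharmonicMaass.IsMeromorphicContinuation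
        (PolyharmonicMaass.completedEisenstein k z)
        (PolyharmonicMaass.completedEisensteinSeries k z) (1 - (k : ℝ) / 2) ∧
      (∀ s : ℂ, ¬ PolyharmonicMaass.IsEisensteinPole k s →
        AnalyticAt ℂ (PolyharmonicMaass.completedEisenstein k z) s ∧
        PolyharmonicMaass.RealDifferentiableAt
          (fun w => PolyharmonicMaass.completedEisenstein k w s) z) ∧
      Differentiable ℂ (PolyharmonicMaass.doublyCompletedEisenstein k z) ∧
      (∀ s : ℂ, PolyharmonicMaass.RealDifferentiableAt
        (fun w => PolyharmonicMaass.doublyCompletedEisenstein k w s) z)) ∧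
    -- the completed series, `k ≤ 0`
    (k ≤ 0 → ∀ (z : ℍ) (s : ℂ), ¬ PolyharmonicMaass.IsEisensteinPole k s →
      PolyharmonicMaass.xi k (fun w => PolyharmonicMaass.completedEisenstein k w s) z =
        PolyharmonicMaass.completedEisenstein (2 - k) z (-conj s)) ∧
    -- the completed series, `k ≥ 2`
    (2 ≤ k → ∀ (z : ℍ) (s : ℂ), ¬ PolyharmonicMaass.IsEisensteinPole (2 - k) (-conj s) →
      PolyharmonicMaass.xi k (fun w => PolyharmonicMaass.completedEisenstein k w s) z =
        conj s * (conj s + (k : ℂ) - 1) *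
          PolyharmonicMaass.completedEisenstein (2 - k) z (-conj s)) ∧
    -- at the removable singularities of the right-hand side, it is read as its limit
    (2 ≤ k → ∀ (z : ℍ) (s : ℂ), PolyharmonicMaass.IsEisensteinPole (2 - k) (-conj s) →
      Tendsto (fun t : ℂ => conj t * (conj t + (k : ℂ) - 1) *
          PolyharmonicMaass.completedEisenstein (2 - k) z (-conj t)) (𝓝[≠] s)
        (𝓝 (PolyharmonicMaass.xi k
          (fun w => PolyharmonicMaass.completedEisenstein k w s) z))) ∧
    -- the doubly-completed series
    (k ≤ 0 → ∀ (z : ℍ) (s : ℂ),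
      PolyharmonicMaass.xi k (fun w => PolyharmonicMaass.doublyCompletedEisenstein k w s) z =
        PolyharmonicMaass.doublyCompletedEisenstein (2 - k) z (-conj s)) ∧
    (2 ≤ k → ∀ (z : ℍ) (s : ℂ),
      PolyharmonicMaass.xi k (fun w => PolyharmonicMaass.doublyCompletedEisenstein k w s) z =
        conj s * (conj s + (k : ℂ) - 1) *
          PolyharmonicMaass.doublyCompletedEisenstein (2 - k) z (-conj s)) := by
  open PolyharmonicMaass in
  refine ⟨fun z => ⟨isMeromorphicContinuation_completedEisenstein hk z,
    fun s hs => ⟨analyticAt_completedEisenstein hk z hs,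
      realDifferentiableAt_completedEisenstein hk hs z⟩,
    differentiable_doublyCompletedEisenstein hk z,
    fun s => realDifferentiableAt_doublyCompletedEisenstein hk s z⟩,
    fun hk0 z s hs => ?_, fun hk2 z s hs => ?_, fun hk2 z s _ => ?_, fun hk0 z s => ?_,
    fun hk2 z s => ?_⟩
  · rw [xi_completedEisenstein hk hs (not_isEisensteinPole_of_ne_zero (by omega) _),
      xiFactor_of_nonpos hk0, one_mul]
  · rw [xi_completedEisenstein hk (not_isEisensteinPole_of_ne_zero (by omega) s) hs,
      xiFactor_of_pos (by omega)]
  · simpa only [xiFactor_of_pos (two_pos.trans_le hk2)] using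
      tendsto_xiFactor_mul_completedEisenstein hk (not_isEisensteinPole_of_ne_zero (by omega) s) z
  · rw [xi_doublyCompletedEisenstein hk, xiFactor_of_nonpos hk0, one_mul]
  · rw [xi_doublyCompletedEisenstein hk, xiFactor_of_pos (by omega)]
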